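/- Let $m\ge 1$ and let $\gamma=(\gamma_1,\dots,\gamma_m)\in\mathbb N^m$ satisfy $2\le\gamma_1\le\dots\le\gamma_m$; put $d=\gamma_1+\dots+\gamma_m$ and let $w_\gamma(r)=\prod_{i=1}^m|r_i|^{\gamma_i-1}$, $r\in\mathbb R^m$. For $\nu\in\mathbb N_0$ and $k\in\mathbb Z^m$ let $Q_{\nu,k}\subset\mathbb R^m$ be the cube with sides parallel to the axes, centre $2^{-\nu}k$ and side length $2^{-\nu}$, and let $w_\gamma(Q_{\nu,k})=\int_{Q_{\nu,k}}w_\gamma(x)\,dx$. For $\sigma\in\mathbb R$ and $0<p,q\le\infty$ let $b^{\sigma}_{p,q}(w_\gamma)$ be the (quasi-)normed space of all families $\lambda=(\lambda_{\nu,k})_{\nu\in\mathbb N_0,\,k\in\mathbb Z^m}$ of complex numbers with $$\|\lambda\,|\,b^{\sigma}_{p,q}(w_\gamma)\|=\Big(\sum_{\nu=0}^\infty 2^{\nu\sigma q}\Big(\sum_{k\in\mathbb Z^m}|\lambda_{\nu,k}|^p\,2^{m\nu}\,w_\gamma(Q_{\nu,k})\Big)^{q/p}\Big)^{1/q}<\infty,$$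 where for $p=\infty$ the inner expression $(\sum_{k}\dots)^{1/p}$ is replaced by $\sup_k|\lambda_{\nu,k}|$, and for $q=\infty$ the outer sum is replaced by a supremum over $\nu$. A bounded linear operator $T:X\to Y$ between (quasi-)Banach spaces is called nuclear if there are bounded linear functionals $a_j$ on $X$ and elements $y_j\in Y$, $j\in\mathbb N_0$, such that $\sum_{j}\|a_j\|\,\|y_j\|_Y<\infty$ and $Tx=\sum_{j=0}^{\infty}a_j(x)\,y_j$, with convergence in $Y$, for every $x\in X$. Let $1\le p_1,p_2\le\infty$, $0<q_1,q_2\le\infty$, $s_1,s_2\in\mathbb R$ and $\sigma_i=s_i+\frac m2-\frac m{p_i}$, $i=1,2$ (with $\frac1\infty=0$). Then $b^{\sigma_1}_{p_1,q_1}(w_\gamma)$ is contained in $b^{\sigma_2}_{p_2,q_2}(w_\gamma)$ with nuclear identity map $$\mathrm{id}:\ b^{\sigma_1}_{p_1,q_1}(w_\gamma)\to b^{\sigma_2}_{p_2,q_2}(w_\gamma)$$ if and only if $$\frac{s_1-s_2}{d}>\frac1{p_1}-\frac1{p_2}>\frac1{\gamma_1}.$$ -/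

import Mathlib

open MeasureTheory Filter Topology
open scoped ENNReal

noncomputable section

/-! ### Weighted `ℓ_p` quasi-norms -/

/-- The weighted `ℓ_p` quasi-norm `(∑ i, f i ^ p * W i) ^ (1 / p)` of a nonnegative family, read as
the supremum `sup_i f i` if `p = ∞`. -/
def weightedLpNorm {ι : Type*} (p : ℝ≥0∞) (W f : ι → ℝ≥0∞) : ℝ≥0∞ :=
  if p = ∞ then ⨆ i, f i else (∑' i, f i ^ p.toReal * W i) ^ (1 / p.toReal)

theorem ennreal_add_rpow_le {t : ℝ} (ht : 0 ≤ t) (a b : ℝ≥0∞) :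
    (a + b) ^ t ≤ 2 ^ t * (a ^ t + b ^ t) := by
  rcases le_total a b with h | h
  · calc (a + b) ^ t ≤ (2 * b) ^ t := by
          refine ENNReal.rpow_le_rpow ?_ ht
          rw [two_mul]; gcongr
      _ = 2 ^ t * b ^ t := ENNReal.mul_rpow_of_nonneg _ _ ht
      _ ≤ _ := by gcongr; exact le_add_self
  · calc (a + b) ^ t ≤ (2 * a) ^ t := by
          refine ENNReal.rpow_le_rpow ?_ ht
          rw [two_mul]; gcongr
      _ = 2 ^ t * a ^ t := ENNReal.mul_rpow_of_nonneg _ _ ht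
      _ ≤ _ := by gcongr; exact le_self_add

theorem weightedLpNorm_add_le {ι : Type*} (p : ℝ≥0∞) :
    ∃ C : ℝ≥0∞, C ≠ ∞ ∧ ∀ W f g h : ι → ℝ≥0∞, (∀ i, h i ≤ f i + g i) →
      weightedLpNorm p W h ≤ C * (weightedLpNorm p W f + weightedLpNorm p W g) := by
  by_cases hp : p = ∞
  · refine ⟨1, by simp, fun W f g h hh => ?_⟩
    simp only [weightedLpNorm, hp, if_true, one_mul]
    exact iSup_le fun i => (hh i).trans (add_le_add (le_iSup f i) (le_iSup g i))
  · set t := p.toReal with htdef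
    have ht : 0 ≤ t := ENNReal.toReal_nonneg
    have ht' : 0 ≤ 1 / t := by positivity
    refine ⟨(2 ^ t) ^ (1 / t) * 2 ^ (1 / t), ?_, fun W f g h hh => ?_⟩
    · exact ENNReal.mul_ne_top
        (ENNReal.rpow_ne_top_of_nonneg ht' (ENNReal.rpow_ne_top_of_nonneg ht (by simp)))
        (ENNReal.rpow_ne_top_of_nonneg ht' (by simp))
    · simp only [weightedLpNorm, hp, if_false, ← htdef]
      have key : ∑' i, h i ^ t * W i ≤
          2 ^ t * (∑' i, f i ^ t * W i + ∑' i, g i ^ t * W i) := by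
        rw [← ENNReal.tsum_add, ← ENNReal.tsum_mul_left]
        refine ENNReal.tsum_le_tsum fun i => ?_
        calc h i ^ t * W i ≤ (2 ^ t * (f i ^ t + g i ^ t)) * W i := by
              gcongr
              exact (ENNReal.rpow_le_rpow (hh i) ht).trans (ennreal_add_rpow_le ht _ _)
          _ = _ := by ring
      calc _ ≤ _ := ENNReal.rpow_le_rpow key ht'
        _ = (2 ^ t) ^ (1 / t) * (∑' i, f i ^ t * W i + ∑' i, g i ^ t * W i) ^ (1 / t) :=
            ENNReal.mul_rpow_of_nonneg _ _ ht'
        _ ≤ _ := by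
            rw [mul_assoc]
            gcongr
            exact ennreal_add_rpow_le ht' _ _

theorem weightedLpNorm_mul_le {ι : Type*} (p : ℝ≥0∞) (c : ℝ≥0∞) (hc : c ≠ ∞) :
    ∃ C : ℝ≥0∞, C ≠ ∞ ∧ ∀ W f h : ι → ℝ≥0∞, (∀ i, h i ≤ c * f i) →
      weightedLpNorm p W h ≤ C * weightedLpNorm p W f := by
  by_cases hp : p = ∞
  · refine ⟨c, hc, fun W f h hh => ?_⟩
    simp only [weightedLpNorm, hp, if_true]
    exact iSup_le fun i => (hh i).trans (by gcongr; exact le_iSup f i)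
  · set t := p.toReal with htdef
    have ht : 0 ≤ t := ENNReal.toReal_nonneg
    have ht' : 0 ≤ 1 / t := by positivity
    refine ⟨(c ^ t) ^ (1 / t),
      ENNReal.rpow_ne_top_of_nonneg ht' (ENNReal.rpow_ne_top_of_nonneg ht hc), fun W f h hh => ?_⟩
    simp only [weightedLpNorm, hp, if_false, ← htdef]
    rw [← ENNReal.mul_rpow_of_nonneg _ _ ht', ← ENNReal.tsum_mul_left]
    refine ENNReal.rpow_le_rpow (ENNReal.tsum_le_tsum fun i => ?_) ht'
    rw [← mul_assoc, ← ENNReal.mul_rpow_of_nonneg _ _ ht]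
    gcongr
    exact hh i

theorem weightedLpNorm_zero {ι : Type*} {p : ℝ≥0∞} (h0 : p ≠ 0) (W : ι → ℝ≥0∞) :
    weightedLpNorm p W (fun _ => 0) = 0 := by
  by_cases hp : p = ∞
  · simp [weightedLpNorm, hp]
  · have h : 0 < p.toReal := ENNReal.toReal_pos h0 hp
    simp [weightedLpNorm, hp, ENNReal.zero_rpow_of_pos h, h]

/-! ### Dyadic cubes and the block weight -/

/-- The dyadic cube `Q_{ν,k}` in `ℝ^m`, centred at `2^{-ν} k` with side length `2^{-ν}`. -/
def dyadicCube {m : ℕ} (ν : ℕ) (k : Fin m → ℤ) : Set (Fin m → ℝ) :=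
  {x | ∀ i, |x i - (2 : ℝ) ^ (-(ν : ℤ)) * (k i : ℝ)| ≤ (2 : ℝ) ^ (-(ν : ℤ)) / 2}

/-- The mass `w(Q) = ∫_Q w(x) dx` of a set for a nonnegative weight `w`. -/
def weightMass {m : ℕ} (w : (Fin m → ℝ) → ℝ) (Q : Set (Fin m → ℝ)) : ℝ≥0∞ :=
  ∫⁻ x in Q, ENNReal.ofReal (w x)

/-- The weight `w_γ(r) = ∏ |r_i| ^ (γ_i - 1)` on `ℝ^m` (used for `γ_i ≥ 1`). -/
def blockWeight {m : ℕ} (γ : Fin m → ℕ) (r : Fin m → ℝ) : ℝ :=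
  ∏ i, |r i| ^ (γ i - 1)

/-! ### The weighted sequence spaces `b^σ_{p,q}(w)` -/

/-- The extended quasi-norm
`(∑_ν 2^{νσq} (∑_k |λ_{ν,k}|^p 2^{mν} w(Q_{ν,k}))^{q/p})^{1/q}`,
with the inner (outer) sum replaced by a supremum if `p = ∞` (`q = ∞`); in particular the weight
does not enter if `p = ∞`. -/
def besovSeqENorm {m : ℕ} (w : (Fin m → ℝ) → ℝ) (σ : ℝ) (p q : ℝ≥0∞)
    (lam : ℕ → (Fin m → ℤ) → ℂ) : ℝ≥0∞ :=
  weightedLpNorm q (fun _ : ℕ => 1) fun ν =>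
    (2 : ℝ≥0∞) ^ ((ν : ℝ) * σ) *
      weightedLpNorm p (fun k => 2 ^ (m * ν) * weightMass w (dyadicCube ν k)) fun k => ‖lam ν k‖ₑ

theorem besovSeqENorm_add_lt_top {m : ℕ} {w : (Fin m → ℝ) → ℝ} {σ : ℝ} {p q : ℝ≥0∞}
    {x y : ℕ → (Fin m → ℤ) → ℂ} (hx : besovSeqENorm w σ p q x < ∞)
    (hy : besovSeqENorm w σ p q y < ∞) : besovSeqENorm w σ p q (x + y) < ∞ := by
  obtain ⟨C, hC, h1⟩ := weightedLpNorm_add_le (ι := Fin m → ℤ) p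
  obtain ⟨D, hD, h2⟩ := weightedLpNorm_add_le (ι := ℕ) q
  obtain ⟨E, hE, h3⟩ := weightedLpNorm_mul_le (ι := ℕ) q C hC
  refine lt_of_le_of_lt (h3 _ _ _ fun ν => ?_) (lt_of_le_of_lt
    (mul_le_mul' (le_refl E) (h2 _ _ _ _ fun ν => le_refl _))
    (ENNReal.mul_lt_top hE.lt_top (ENNReal.mul_lt_top hD.lt_top (ENNReal.add_lt_top.2 ⟨hx, hy⟩))))
  rw [← mul_add, mul_left_comm]
  refine mul_le_mul' (le_refl _) (h1 _ _ _ _ fun k => ?_)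
  exact enorm_add_le _ _

theorem besovSeqENorm_smul_lt_top {m : ℕ} {w : (Fin m → ℝ) → ℝ} {σ : ℝ} {p q : ℝ≥0∞}
    (c : ℂ) {x : ℕ → (Fin m → ℤ) → ℂ} (hx : besovSeqENorm w σ p q x < ∞) :
    besovSeqENorm w σ p q (c • x) < ∞ := by
  obtain ⟨C, hC, h1⟩ := weightedLpNorm_mul_le (ι := Fin m → ℤ) p ‖c‖ₑ enorm_ne_top
  obtain ⟨E, hE, h3⟩ := weightedLpNorm_mul_le (ι := ℕ) q C hC
  refine lt_of_le_of_lt (h3 _ _ _ fun ν => ?_) (ENNReal.mul_lt_top hE.lt_top hx)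
  rw [mul_left_comm]
  refine mul_le_mul' (le_refl _) (h1 _ _ _ fun k => ?_)
  simp

theorem besovSeqENorm_zero {m : ℕ} (w : (Fin m → ℝ) → ℝ) (σ : ℝ) {p q : ℝ≥0∞}
    (hp : 0 < p) (hq : 0 < q) : besovSeqENorm w σ p q 0 = 0 := by
  simp [besovSeqENorm, weightedLpNorm_zero hp.ne', weightedLpNorm_zero hq.ne']

/-- The weighted sequence space `b^σ_{p,q}(w)`, for `0 < p, q ≤ ∞`. -/
def BesovSeq {m : ℕ} (w : (Fin m → ℝ) → ℝ) (σ : ℝ) (p q : ℝ≥0∞) (hp : 0 < p) (hq : 0 < q) :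
    Submodule ℂ (ℕ → (Fin m → ℤ) → ℂ) where
  carrier := {lam | besovSeqENorm w σ p q lam < ∞}
  add_mem' := besovSeqENorm_add_lt_top
  zero_mem' := by
    simp only [Set.mem_ofPred_eq, besovSeqENorm_zero w σ hp hq, ENNReal.zero_lt_top]
  smul_mem' := fun c _ hx => besovSeqENorm_smul_lt_top c hx

/-- The quasi-norm of `b^σ_{p,q}(w)`. -/
instance BesovSeq.instNorm {m : ℕ} (w : (Fin m → ℝ) → ℝ) (σ : ℝ) (p q : ℝ≥0∞)
    (hp : 0 < p) (hq : 0 < q) : Norm (BesovSeq w σ p q hp hq) where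
  norm lam := (besovSeqENorm w σ p q (lam : ℕ → (Fin m → ℤ) → ℂ)).toReal

/-! ### Nuclear operators between quasi-normed spaces

Only the (quasi-)norm function of the spaces enters, so that the definitions apply to Banach and to
quasi-Banach spaces alike. -/

/-- Boundedness of a linear operator with respect to the (quasi-)norms of the two spaces. -/
def IsBoundedOperator {X Y : Type*} [AddCommGroup X] [Module ℂ X] [Norm X]
    [AddCommGroup Y] [Module ℂ Y] [Norm Y] (T : X →ₗ[ℂ] Y) : Prop :=
  ∃ C : ℝ, ∀ x, ‖T x‖ ≤ C * ‖x‖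

/-- The norm `‖a‖ = sup {|a x| : ‖x‖ ≤ 1}` of a (bounded) linear functional. -/
def functionalNorm {X : Type*} [AddCommGroup X] [Module ℂ X] [Norm X] (a : X →ₗ[ℂ] ℂ) : ℝ :=
  sSup {r : ℝ | ∃ x : X, ‖x‖ ≤ 1 ∧ r = ‖a x‖}

/-- A bounded operator `T : X → Y` is nuclear if there are bounded linear functionals `a_j` on `X`
and elements `y_j` of `Y` with `∑ ‖a_j‖ ‖y_j‖ < ∞` and `T x = ∑ a_j(x) y_j` for every `x`, the
series converging in the (quasi-)norm of `Y`. -/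
def IsNuclearOperator {X Y : Type*} [AddCommGroup X] [Module ℂ X] [Norm X]
    [AddCommGroup Y] [Module ℂ Y] [Norm Y] (T : X →ₗ[ℂ] Y) : Prop :=
  IsBoundedOperator T ∧
    ∃ (a : ℕ → X →ₗ[ℂ] ℂ) (y : ℕ → Y), (∀ j, IsBoundedOperator (a j)) ∧
      Summable (fun j => functionalNorm (a j) * ‖y j‖) ∧
      ∀ x, Tendsto (fun N => ‖T x - ∑ j ∈ Finset.range N, a j x • y j‖) atTop (𝓝 0)

/-- The identity is a nuclear operator from the subspace `E` into the subspace `F`: the space `E` is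
contained in `F` and the inclusion is nuclear. -/
def IdIsNuclear {V : Type*} [AddCommGroup V] [Module ℂ V] (E F : Submodule ℂ V)
    [Norm E] [Norm F] : Prop :=
  ∃ h : E ≤ F, IsNuclearOperator (Submodule.inclusion h)

end

/-!
Since `|x_i|` is of order `2^{-ν} (|k_i| + 1)` on `Q_{ν,k}`, the mean of `w_γ` over `Q_{ν,k}` is,
up to constants, `2^{E(ν,k)}` with `E(ν,k) = ∑ (γ_i - 1) (size |k_i| - ν)`, where `size` is the
number of binary digits. Put `t = 1/p₁ - 1/p₂`.

*Necessity.* No nuclear map fixes infinitely many unit sequences of comparable norm in source and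
target. At `k = 0`, `ν → ∞`, this gives the condition on `s₁ - s₂`; at `ν = 0`, `k → ∞`, it gives
`t > 0`. Trace duality bounds `|∑ f_i(x_i)|` by a multiple of the norm of the operator
`∑ f_i(·) x_i` from the target to the source. By Hölder's inequality a diagonal operator on the
level `ν = 0` is bounded by a weighted `ℓ_{1/t}`-norm of its diagonal, and the extremal diagonal
shows that `∑_k w_γ(Q_{0,k})^{-t/(1-t)}` is finite. Hence `t γ_i > 1`.

*Sufficiency.* Expanding the identity in unit sequences loses too much: it would need
`t (γ_i - 1) > 1`. Instead group the indices `k` into the blocks `B` on which all `size |k_i|` are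
constant, so that the weight is essentially a constant `W` on `B`, and expand in the discrete
Fourier basis of each block. The vectors of this basis are flat, so that `‖a_j‖ ‖y_j‖` is of order
`2^{-ν (σ₁ - σ₂)} (#B W)^{-t}`, and the sum over all levels and indices is a product of geometric
series, which converge under the two conditions.
-/

section WeightedLp

variable {ι κ : Type*}

theorem weightedLpNorm_mono (p : ℝ≥0∞) (W : ι → ℝ≥0∞) {f g : ι → ℝ≥0∞} (h : ∀ i, f i ≤ g i) :
    weightedLpNorm p W f ≤ weightedLpNorm p W g := by
  unfold weightedLpNorm
  split_ifs
  · exact iSup_mono h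
  · gcongr with i
    exact h i

theorem weightedLpNorm_const_mul {p : ℝ≥0∞} (hp : p ≠ 0) (W : ι → ℝ≥0∞) (c : ℝ≥0∞)
    (f : ι → ℝ≥0∞) : weightedLpNorm p W (fun i => c * f i) = c * weightedLpNorm p W f := by
  unfold weightedLpNorm
  split_ifs with h
  · rw [ENNReal.mul_iSup]
  · have ht : 0 < p.toReal := ENNReal.toReal_pos hp h
    simp_rw [ENNReal.mul_rpow_of_nonneg _ _ ht.le, mul_assoc]
    rw [ENNReal.tsum_mul_left, ENNReal.mul_rpow_of_nonneg _ _ (by positivity), ← ENNReal.rpow_mul,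
      mul_one_div_cancel ht.ne', ENNReal.rpow_one]

theorem weightedLpNorm_eq_of_ne_top {p : ℝ≥0∞} (hp : p ≠ 0) (hp' : p ≠ ∞) (W f : ι → ℝ≥0∞) :
    weightedLpNorm p W f =
      (∑' i, (f i * W i ^ (p⁻¹).toReal) ^ p.toReal) ^ (1 / p.toReal) := by
  have ht : 0 < p.toReal := ENNReal.toReal_pos hp hp'
  simp only [weightedLpNorm, hp', if_false]
  simp_rw [ENNReal.mul_rpow_of_nonneg _ _ ht.le, ← ENNReal.rpow_mul, ENNReal.toReal_inv,
    inv_mul_cancel₀ ht.ne', ENNReal.rpow_one]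

theorem mul_rpow_le_weightedLpNorm {p : ℝ≥0∞} (hp : p ≠ 0) (W f : ι → ℝ≥0∞) (i : ι) :
    f i * W i ^ (p⁻¹).toReal ≤ weightedLpNorm p W f := by
  by_cases h : p = ∞
  · simpa [weightedLpNorm, h] using le_iSup f i
  · have ht : 0 < p.toReal := ENNReal.toReal_pos hp h
    rw [weightedLpNorm_eq_of_ne_top hp h, one_div, ENNReal.le_rpow_inv_iff ht]
    exact ENNReal.le_tsum (f := fun i => (f i * W i ^ (p⁻¹).toReal) ^ p.toReal) i

theorem weightedLpNorm_eq_of_support {p : ℝ≥0∞} (hp : p ≠ 0) (W f : ι → ℝ≥0∞) (i : ι)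
    (hf : ∀ j, j ≠ i → f j = 0) : weightedLpNorm p W f = f i * W i ^ (p⁻¹).toReal := by
  refine le_antisymm ?_ (mul_rpow_le_weightedLpNorm hp W f i)
  by_cases h : p = ∞
  · simp only [weightedLpNorm, h, if_true, ENNReal.inv_top, ENNReal.toReal_zero, ENNReal.rpow_zero,
      mul_one]
    refine iSup_le fun j => ?_
    by_cases hj : j = i
    · rw [hj]
    · simp [hf j hj]
  · have ht : 0 < p.toReal := ENNReal.toReal_pos hp h
    rw [weightedLpNorm_eq_of_ne_top hp h, tsum_eq_single i, ← ENNReal.rpow_mul,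
      mul_one_div_cancel ht.ne', ENNReal.rpow_one]
    intro j hj
    rw [hf j hj, zero_mul, ENNReal.zero_rpow_of_pos ht]

theorem weightedLpNorm_le_of_subset {p : ℝ≥0∞} (hp : p ≠ 0) {W f : ι → ℝ≥0∞} (S : Finset ι)
    {B : ℝ≥0∞} (hf : ∀ i, f i ≤ 1) (hS : ∀ i ∉ S, f i = 0) (hW : ∀ i ∈ S, W i ≤ B) :
    weightedLpNorm p W f ≤ (S.card * B) ^ (p⁻¹).toReal := by
  by_cases h : p = ∞
  · simp [weightedLpNorm, h, hf]
  · have ht : 0 < p.toReal := ENNReal.toReal_pos hp h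
    rw [ENNReal.toReal_inv, ← one_div]
    simp only [weightedLpNorm, h, if_false]
    gcongr
    rw [tsum_eq_sum (s := S) fun i hi => by rw [hS i hi, ENNReal.zero_rpow_of_pos ht, zero_mul],
      ← nsmul_eq_mul]
    refine Finset.sum_le_card_nsmul _ _ _ fun i hi => ?_
    calc f i ^ p.toReal * W i ≤ 1 ^ p.toReal * B := by
          gcongr
          exacts [hf i, hW i hi]
      _ = B := by rw [ENNReal.one_rpow, one_mul]

theorem Lp_sum_le_sum_Lp {t : ℝ} (ht : 1 ≤ t) (F : Finset κ) (s : Finset ι) (g : κ → ι → ℝ≥0∞) :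
    (∑ i ∈ s, (∑ j ∈ F, g j i) ^ t) ^ (1 / t) ≤ ∑ j ∈ F, (∑ i ∈ s, g j i ^ t) ^ (1 / t) := by
  classical
  induction F using Finset.induction_on with
  | empty => simp [zero_lt_one.trans_le ht]
  | insert a F ha ih =>
    simp_rw [Finset.sum_insert ha]
    exact (ENNReal.Lp_add_le s _ _ ht).trans (by gcongr)

theorem Lp_tsum_le_tsum_Lp {t : ℝ} (ht : 1 ≤ t) (g : κ → ι → ℝ≥0∞) :
    (∑' i, (∑' j, g j i) ^ t) ^ (1 / t) ≤ ∑' j, (∑' i, g j i ^ t) ^ (1 / t) := by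
  have ht0 : 0 < t := zero_lt_one.trans_le ht
  rw [one_div, ENNReal.rpow_inv_le_iff ht0]
  refine ENNReal.summable.tsum_le_of_sum_le fun s => ?_
  have hlim : Tendsto (fun F : Finset κ => ∑ i ∈ s, (∑ j ∈ F, g j i) ^ t) atTop
      (𝓝 (∑ i ∈ s, (∑' j, g j i) ^ t)) :=
    tendsto_finsetSum _ fun i _ =>
      (ENNReal.continuous_rpow_const.tendsto _).comp ENNReal.summable.hasSum
  refine le_of_tendsto' hlim fun F => ?_
  rw [← ENNReal.rpow_inv_le_iff ht0, ← one_div]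
  refine (Lp_sum_le_sum_Lp ht F s g).trans ?_
  refine (Finset.sum_le_sum fun j _ => ?_).trans (ENNReal.sum_le_tsum F)
  gcongr
  exact ENNReal.sum_le_tsum s

theorem weightedLpNorm_tsum_le {p : ℝ≥0∞} (hp : 1 ≤ p) (W : ι → ℝ≥0∞) (g : κ → ι → ℝ≥0∞) :
    weightedLpNorm p W (fun i => ∑' j, g j i) ≤ ∑' j, weightedLpNorm p W (g j) := by
  by_cases h : p = ∞
  · simp only [weightedLpNorm, h, if_true]
    exact iSup_le fun i => ENNReal.tsum_le_tsum fun j => le_iSup (g j) i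
  · have h0 : p ≠ 0 := (zero_lt_one.trans_le hp).ne'
    simp_rw [weightedLpNorm_eq_of_ne_top h0 h, ← ENNReal.tsum_mul_right]
    refine Lp_tsum_le_tsum_Lp ?_ _
    simpa using ENNReal.toReal_mono h hp

theorem tsum_mul_rpow_le_mul_iSup {t : ℝ} (ht : 0 < t) (W r f : ι → ℝ≥0∞) :
    (∑' i, (r i * f i) ^ (1 / t) * W i) ^ t ≤ (∑' i, r i ^ (1 / t) * W i) ^ t * ⨆ i, f i := by
  have hsum : ∑' i, (r i * f i) ^ (1 / t) * W i ≤
      (∑' i, r i ^ (1 / t) * W i) * (⨆ i, f i) ^ (1 / t) := by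
    rw [← ENNReal.tsum_mul_right]
    refine ENNReal.tsum_le_tsum fun i => ?_
    rw [ENNReal.mul_rpow_of_nonneg _ _ (by positivity), mul_right_comm]
    gcongr
    exact le_iSup f i
  refine (ENNReal.rpow_le_rpow hsum ht.le).trans_eq ?_
  rw [ENNReal.mul_rpow_of_nonneg _ _ ht.le, ← ENNReal.rpow_mul, one_div_mul_cancel ht.ne',
    ENNReal.rpow_one]

theorem tsum_mul_rpow_le_mul_tsum_rpow {p₁ p₂ t : ℝ} (hp₁ : 0 < p₁) (hp₂ : 0 < p₂) (ht : 0 < t)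
    (h : p₁⁻¹ = t + p₂⁻¹) (W r f : ι → ℝ≥0∞) :
    (∑' i, (r i * f i) ^ p₁ * W i) ^ (1 / p₁) ≤
      (∑' i, r i ^ (1 / t) * W i) ^ t * (∑' i, f i ^ p₂ * W i) ^ (1 / p₂) := by
  let _ : MeasurableSpace ι := ⊤
  have hlt : p₁ < 1 / t := by
    rw [lt_one_div hp₁ ht, one_div, h]
    exact lt_add_of_pos_right t (inv_pos.2 hp₂)
  have holder := ENNReal.lintegral_Lp_mul_le_Lq_mul_Lr (r := p₂) hp₁ hlt
    (by rw [one_div, h, one_div_one_div, one_div]) Measure.count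
    (f := fun i => r i * W i ^ t) (g := fun i => f i * W i ^ p₂⁻¹)
    (Measurable.aemeasurable fun _ _ => trivial) (Measurable.aemeasurable fun _ _ => trivial)
  have hW (q : ℝ) (hq : 0 < q) (a w : ℝ≥0∞) : (a * w ^ q⁻¹) ^ q = a ^ q * w := by
    rw [ENNReal.mul_rpow_of_nonneg _ _ hq.le, ← ENNReal.rpow_mul, inv_mul_cancel₀ hq.ne',
      ENNReal.rpow_one]
  have hprod (i : ι) : r i * W i ^ t * (f i * W i ^ p₂⁻¹) = r i * f i * W i ^ p₁⁻¹ := by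
    rw [mul_mul_mul_comm, ← ENNReal.rpow_add_of_nonneg _ _ ht.le (by positivity), h]
  have hr (i : ι) : (r i * W i ^ t) ^ (1 / t) = r i ^ (1 / t) * W i := by
    simpa only [inv_inv, one_div] using hW t⁻¹ (inv_pos.2 ht) (r i) (W i)
  simpa only [lintegral_count, Pi.mul_apply, hprod, hW p₁ hp₁, hW p₂ hp₂, hr, one_div_one_div]
    using holder

theorem weightedLpNorm_mul_le_Lp_mul_Lq {p₁ p₂ : ℝ≥0∞} (hp₁ : p₁ ≠ 0) (hp₂ : p₂ ≠ 0) {t : ℝ}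
    (ht : 0 < t) (h : (p₁⁻¹).toReal = t + (p₂⁻¹).toReal) (W r f : ι → ℝ≥0∞) :
    weightedLpNorm p₁ W (fun i => r i * f i) ≤
      (∑' i, r i ^ (1 / t) * W i) ^ t * weightedLpNorm p₂ W f := by
  have h₁ : p₁ ≠ ∞ := by
    rintro rfl
    rw [ENNReal.inv_top, ENNReal.toReal_zero] at h
    linarith [ENNReal.toReal_nonneg (a := p₂⁻¹)]
  rcases eq_or_ne p₂ ∞ with rfl | h₂
  · have ht₁ : p₁.toReal = 1 / t := by
      rw [ENNReal.inv_top, ENNReal.toReal_zero, add_zero, ENNReal.toReal_inv] at h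
      rw [← h, one_div, inv_inv]
    simpa only [weightedLpNorm, h₁, if_true, if_false, ht₁, one_div_one_div]
      using tsum_mul_rpow_le_mul_iSup ht W r f
  · rw [ENNReal.toReal_inv, ENNReal.toReal_inv] at h
    simpa only [weightedLpNorm, h₁, h₂, if_false] using tsum_mul_rpow_le_mul_tsum_rpow
      (ENNReal.toReal_pos hp₁ h₁) (ENNReal.toReal_pos hp₂ h₂) ht h W r f

theorem inv_card_mul_sum_le_weightedLpNorm {p : ℝ≥0∞} (hp : 1 ≤ p) {W : ι → ℝ≥0∞}
    (f : ι → ℝ≥0∞) {S : Finset ι} (hS : S.Nonempty) {c : ℝ≥0∞} (hc : c ≠ 0) (hc' : c ≠ ∞)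
    (hW : ∀ i ∈ S, c ≤ W i) :
    (S.card : ℝ≥0∞)⁻¹ * ∑ i ∈ S, f i ≤
      (S.card * c) ^ (-(p⁻¹).toReal) * weightedLpNorm p W f := by
  have n0 : (S.card : ℝ≥0∞) ≠ 0 := by simpa using hS.ne_empty
  have n1 : (S.card : ℝ≥0∞) ≠ ∞ := ENNReal.natCast_ne_top _
  by_cases h : p = ∞
  · simp only [weightedLpNorm, h, if_true, ENNReal.inv_top, ENNReal.toReal_zero, neg_zero,
      ENNReal.rpow_zero, one_mul]
    calc (S.card : ℝ≥0∞)⁻¹ * ∑ i ∈ S, f i ≤ (S.card : ℝ≥0∞)⁻¹ * (S.card • ⨆ i, f i) := by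
          gcongr
          exact Finset.sum_le_card_nsmul _ _ _ fun i _ => le_iSup f i
      _ = _ := by rw [nsmul_eq_mul, ← mul_assoc, ENNReal.inv_mul_cancel n0 n1, one_mul]
  · have t1 : 1 ≤ p.toReal := by simpa using ENNReal.toReal_mono h hp
    have ht : 0 < p.toReal := zero_lt_one.trans_le t1
    simp only [weightedLpNorm, h, if_false, ENNReal.toReal_inv]
    rw [ENNReal.rpow_neg, ← ENNReal.inv_rpow, one_div,
      ← ENNReal.mul_rpow_of_nonneg _ _ (by positivity), ENNReal.le_rpow_inv_iff ht, Finset.mul_sum]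
    refine (ENNReal.rpow_arith_mean_le_arith_mean_rpow S (fun _ => (S.card : ℝ≥0∞)⁻¹) f ?_ t1).trans
      ?_
    · rw [Finset.sum_const, nsmul_eq_mul, ENNReal.mul_inv_cancel n0 n1]
    rw [ENNReal.mul_inv (Or.inl n0) (Or.inl n1), mul_assoc, ← ENNReal.tsum_mul_left,
      ← Finset.mul_sum]
    gcongr
    refine (Finset.sum_le_sum fun i hi => ?_).trans (ENNReal.sum_le_tsum S)
    calc f i ^ p.toReal = c⁻¹ * (f i ^ p.toReal * c) := by
          rw [mul_left_comm, ENNReal.inv_mul_cancel hc hc', mul_one]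
      _ ≤ _ := by
          gcongr
          exact hW i hi

end WeightedLp

section TwoRpow

theorem ofReal_two_rpow (x : ℝ) : ENNReal.ofReal (2 ^ x) = 2 ^ x := by
  rw [← ENNReal.ofReal_rpow_of_pos two_pos, ENNReal.ofReal_ofNat]

theorem two_rpow_ne_top (x : ℝ) : (2 : ℝ≥0∞) ^ x ≠ ∞ := by
  rw [← ofReal_two_rpow]
  exact ENNReal.ofReal_ne_top

theorem two_rpow_ne_zero (x : ℝ) : (2 : ℝ≥0∞) ^ x ≠ 0 := by
  rw [← ofReal_two_rpow]
  exact (ENNReal.ofReal_pos.2 (Real.rpow_pos_of_pos two_pos x)).ne'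

theorem two_rpow_add (x y : ℝ) : (2 : ℝ≥0∞) ^ (x + y) = 2 ^ x * 2 ^ y :=
  ENNReal.rpow_add _ _ two_ne_zero ENNReal.ofNat_ne_top

theorem two_rpow_le_two_rpow {x y : ℝ} (h : x ≤ y) : (2 : ℝ≥0∞) ^ x ≤ 2 ^ y :=
  ENNReal.rpow_le_rpow_of_exponent_le one_le_two h

end TwoRpow

section CubeMean

variable {m : ℕ}

/-- The mean `2^{mν} w(Q_{ν,k})` of `w` over the dyadic cube `Q_{ν,k}`, whose volume is `2^{-mν}`.
These means are the weights of the inner sums of `besovSeqENorm`. -/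
noncomputable def cubeMean (w : (Fin m → ℝ) → ℝ) (ν : ℕ) (k : Fin m → ℤ) : ℝ≥0∞ :=
  2 ^ (m * ν) * weightMass w (dyadicCube ν k)

theorem dyadicCube_eq_Icc (ν : ℕ) (k : Fin m → ℤ) :
    ∃ a : Fin m → ℝ, dyadicCube ν k = Set.Icc a fun i => a i + 1 * (2 : ℝ) ^ (-(ν : ℤ)) := by
  refine ⟨fun i => (2 : ℝ) ^ (-(ν : ℤ)) * k i - (2 : ℝ) ^ (-(ν : ℤ)) / 2, Set.ext fun x => ?_⟩
  simp only [dyadicCube, Set.mem_ofPred_eq, abs_le, Set.mem_Icc, Pi.le_def, ← forall_and]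
  refine forall_congr' fun i => and_congr ?_ ?_ <;> constructor <;> intro h <;> linarith

theorem two_pow_mul_volume_Icc (ν : ℕ) (a : Fin m → ℝ) {c : ℝ} (hc : 0 ≤ c) :
    2 ^ (m * ν) * volume (Set.Icc a fun i => a i + c * (2 : ℝ) ^ (-(ν : ℤ))) =
      ENNReal.ofReal (c ^ m) := by
  have h2 : (2 : ℝ≥0∞) ^ (m * ν) = ENNReal.ofReal ((2 ^ ν) ^ m) := by
    rw [← pow_mul, mul_comm, ENNReal.ofReal_pow two_pos.le, ENNReal.ofReal_ofNat]
  simp_rw [Real.volume_Icc_pi, add_sub_cancel_left]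
  rw [Finset.prod_const, Finset.card_univ, Fintype.card_fin, ← ENNReal.ofReal_pow (by positivity),
    h2, ← ENNReal.ofReal_mul (by positivity), ← mul_pow, zpow_neg, zpow_natCast, mul_left_comm,
    mul_inv_cancel₀ (by positivity), mul_one]

theorem cubeMean_le {w : (Fin m → ℝ) → ℝ} {ν : ℕ} {k : Fin m → ℤ} {b : ℝ}
    (hb : ∀ x ∈ dyadicCube ν k, w x ≤ b) : cubeMean w ν k ≤ ENNReal.ofReal b := by
  obtain ⟨a, ha⟩ := dyadicCube_eq_Icc ν k
  calc cubeMean w ν k ≤ 2 ^ (m * ν) * ∫⁻ _ in dyadicCube ν k, ENNReal.ofReal b := by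
        rw [cubeMean, weightMass]
        gcongr 2 ^ (m * ν) * ?_
        exact setLIntegral_mono' (ha ▸ measurableSet_Icc) fun x hx =>
          ENNReal.ofReal_le_ofReal (hb x hx)
    _ = ENNReal.ofReal b := by
        rw [setLIntegral_const, mul_left_comm, ha, two_pow_mul_volume_Icc ν a zero_le_one, one_pow,
          ENNReal.ofReal_one, mul_one]

theorem le_cubeMean {w : (Fin m → ℝ) → ℝ} {ν : ℕ} {k : Fin m → ℤ} {a : Fin m → ℝ} {b c : ℝ}
    (hc : 0 ≤ c)
    (ha : Set.Icc a (fun i => a i + c * (2 : ℝ) ^ (-(ν : ℤ))) ⊆ dyadicCube ν k)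
    (hb : ∀ x ∈ Set.Icc a fun i => a i + c * (2 : ℝ) ^ (-(ν : ℤ)), b ≤ w x) :
    ENNReal.ofReal (c ^ m * b) ≤ cubeMean w ν k := by
  set R := Set.Icc a fun i => a i + c * (2 : ℝ) ^ (-(ν : ℤ))
  calc ENNReal.ofReal (c ^ m * b) = 2 ^ (m * ν) * ∫⁻ _ in R, ENNReal.ofReal b := by
        rw [setLIntegral_const, mul_left_comm, two_pow_mul_volume_Icc ν a hc,
          ENNReal.ofReal_mul (by positivity), mul_comm]
    _ ≤ 2 ^ (m * ν) * ∫⁻ x in R, ENNReal.ofReal (w x) := by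
        gcongr 2 ^ (m * ν) * ?_
        exact setLIntegral_mono' measurableSet_Icc fun x hx => ENNReal.ofReal_le_ofReal (hb x hx)
    _ ≤ cubeMean w ν k := by
        rw [cubeMean, weightMass]
        gcongr

end CubeMean

section BlockWeight

variable {m : ℕ} {γ : Fin m → ℕ}

/-- The exponent `e` for which the mean of `w_γ` over `Q_{ν,k}` is comparable to `2 ^ e`. On
`Q_{ν,k}` the coordinate `|x_i|` has the order of magnitude `2^{-ν} (|k_i| + 1)`, and `|k_i| + 1` is
encoded by its binary order `2 ^ size |k_i|`. -/
noncomputable def weightExponent (γ : Fin m → ℕ) (ν : ℕ) (k : Fin m → ℤ) : ℝ :=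
  ∑ i, ((γ i : ℝ) - 1) * ((Nat.size (k i).natAbs : ℝ) - ν)

theorem abs_add_one_le_two_pow_size (k : ℤ) : |(k : ℝ)| + 1 ≤ 2 ^ Nat.size k.natAbs := by
  rw [← Int.cast_abs, ← Nat.cast_natAbs]
  exact_mod_cast Nat.lt_size_self k.natAbs

theorem two_pow_size_le (k : ℤ) : (2 : ℝ) ^ Nat.size k.natAbs ≤ 2 * |(k : ℝ)| + 1 := by
  rw [← Int.cast_abs, ← Nat.cast_natAbs]
  rcases Nat.eq_zero_or_pos (Nat.size k.natAbs) with h | h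
  · simp [h]
  · have hk : 2 ^ (Nat.size k.natAbs - 1) ≤ k.natAbs := Nat.lt_size.1 (Nat.sub_one_lt h.ne')
    have hpow : 2 ^ Nat.size k.natAbs = 2 * 2 ^ (Nat.size k.natAbs - 1) := by
      rw [← pow_succ', Nat.sub_add_cancel h]
    exact_mod_cast (by omega : 2 ^ Nat.size k.natAbs ≤ 2 * k.natAbs + 1)

theorem two_rpow_weightExponent (hγ : ∀ i, 1 ≤ γ i) (ν : ℕ) (k : Fin m → ℤ) :
    (2 : ℝ) ^ weightExponent γ ν k =
      ∏ i, ((2 : ℝ) ^ (-(ν : ℤ)) * 2 ^ Nat.size (k i).natAbs) ^ (γ i - 1) := by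
  rw [weightExponent, Real.rpow_sum_of_pos two_pos]
  refine Finset.prod_congr rfl fun i _ => ?_
  rw [← Nat.cast_pred (hγ i), mul_comm ((γ i - 1 : ℕ) : ℝ), Real.rpow_mul two_pos.le,
    Real.rpow_natCast, sub_eq_neg_add, Real.rpow_add two_pos, Real.rpow_natCast,
    ← Real.rpow_intCast, Int.cast_neg, Int.cast_natCast]

theorem blockWeight_le_two_rpow (hγ : ∀ i, 1 ≤ γ i) {ν : ℕ} {k : Fin m → ℤ} {x : Fin m → ℝ}
    (hx : x ∈ dyadicCube ν k) : blockWeight γ x ≤ 2 ^ weightExponent γ ν k := by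
  rw [two_rpow_weightExponent hγ, blockWeight]
  gcongr with i
  set h : ℝ := (2 : ℝ) ^ (-(ν : ℤ))
  have h0 : 0 < h := by positivity
  calc |x i| = |(x i - h * k i) + h * k i| := by rw [sub_add_cancel]
    _ ≤ |x i - h * k i| + |h * k i| := abs_add_le _ _
    _ ≤ h / 2 + h * |(k i : ℝ)| := by
        rw [abs_mul, abs_of_pos h0]
        gcongr
        exact hx i
    _ ≤ h * (|(k i : ℝ)| + 1) := by linarith
    _ ≤ h * 2 ^ Nat.size (k i).natAbs := by
        gcongr
        exact abs_add_one_le_two_pow_size (k i)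

theorem cubeMean_blockWeight_le (hγ : ∀ i, 1 ≤ γ i) (ν : ℕ) (k : Fin m → ℤ) :
    cubeMean (blockWeight γ) ν k ≤ 2 ^ weightExponent γ ν k := by
  rw [← ofReal_two_rpow]
  exact cubeMean_le fun x hx => blockWeight_le_two_rpow hγ hx

theorem exists_quarter_interval {h : ℝ} (h0 : 0 < h) (k : ℤ) :
    ∃ a, ∀ x ∈ Set.Icc a (a + 1 / 4 * h), |x - h * k| ≤ h / 2 ∧ h * (|(k : ℝ)| + 1 / 4) ≤ |x| := by
  rcases le_or_gt 0 k with hk | hk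
  · refine ⟨h * (k + 1 / 4), fun x ⟨h1, h2⟩ => ⟨abs_le.2 ⟨?_, ?_⟩, ?_⟩⟩
    · linarith
    · linarith
    · rw [abs_of_nonneg (Int.cast_nonneg hk)]
      exact h1.trans (le_abs_self x)
  · refine ⟨h * (k - 1 / 2), fun x ⟨h1, h2⟩ => ⟨abs_le.2 ⟨?_, ?_⟩, ?_⟩⟩
    · linarith
    · linarith
    · rw [abs_of_neg (Int.cast_lt_zero.2 hk)]
      exact le_trans (by linarith) (neg_le_abs x)

theorem le_cubeMean_blockWeight (hγ : ∀ i, 1 ≤ γ i) (ν : ℕ) (k : Fin m → ℤ) :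
    2 ^ (weightExponent γ ν k - 2 * ∑ i, (γ i : ℝ)) ≤ cubeMean (blockWeight γ) ν k := by
  set h : ℝ := (2 : ℝ) ^ (-(ν : ℤ)) with hh
  choose a ha using fun i => exists_quarter_interval (by positivity : 0 < h) (k i)
  have hb : ∀ x ∈ Set.Icc a fun i => a i + 1 / 4 * h,
      ∏ i, (1 / 4 * (h * 2 ^ Nat.size (k i).natAbs)) ^ (γ i - 1) ≤ blockWeight γ x := by
    intro x hx
    unfold blockWeight
    gcongr with i
    refine le_trans ?_ (ha i (x i) ⟨hx.1 i, hx.2 i⟩).2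
    rw [mul_left_comm]
    gcongr
    linarith [two_pow_size_le (k i), abs_nonneg (k i : ℝ)]
  refine le_trans (le_of_eq ?_) (le_cubeMean (by norm_num)
    (fun x hx i => (ha i (x i) ⟨hx.1 i, hx.2 i⟩).1) hb)
  have h4 : (2 : ℝ) ^ (2 * ∑ i, (γ i : ℝ)) = ∏ i, 4 ^ γ i := by
    rw [Real.rpow_mul two_pos.le, Real.rpow_sum_of_pos (by positivity)]
    norm_num
  rw [← ofReal_two_rpow, Real.rpow_sub two_pos, h4, two_rpow_weightExponent hγ, ← hh,
    ← Finset.prod_div_distrib, ← Fin.prod_const, ← Finset.prod_mul_distrib]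
  refine congrArg ENNReal.ofReal (Finset.prod_congr rfl fun i _ => ?_)
  obtain ⟨n, hn⟩ := Nat.exists_eq_add_of_le' (hγ i)
  rw [hn, Nat.add_sub_cancel, pow_succ, mul_pow (1 / 4 : ℝ), one_div_pow]
  ring

theorem cubeMean_blockWeight_ne_top (hγ : ∀ i, 1 ≤ γ i) (ν : ℕ) (k : Fin m → ℤ) :
    cubeMean (blockWeight γ) ν k ≠ ∞ :=
  ne_top_of_le_ne_top (two_rpow_ne_top _) (cubeMean_blockWeight_le hγ ν k)

theorem cubeMean_blockWeight_ne_zero (hγ : ∀ i, 1 ≤ γ i) (ν : ℕ) (k : Fin m → ℤ) :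
    cubeMean (blockWeight γ) ν k ≠ 0 :=
  ((two_rpow_ne_zero _).bot_lt.trans_le (le_cubeMean_blockWeight hγ ν k)).ne'

end BlockWeight

section NuclearOperator

variable {X Y : Type*} [AddCommGroup X] [Module ℂ X] [Norm X] [AddCommGroup Y] [Module ℂ Y]
  [Norm Y]

theorem functionalNorm_nonneg (a : X →ₗ[ℂ] ℂ) : 0 ≤ functionalNorm a :=
  Real.sSup_nonneg (by rintro r ⟨x, -, rfl⟩; exact norm_nonneg _)

theorem functionalNorm_le {a : X →ₗ[ℂ] ℂ} {C : ℝ} (hC : 0 ≤ C) (h : ∀ x, ‖a x‖ ≤ C * ‖x‖) :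
    functionalNorm a ≤ C := by
  refine Real.sSup_le ?_ hC
  rintro r ⟨x, hx, rfl⟩
  exact (h x).trans (mul_le_of_le_one_right hC hx)

theorem norm_le_functionalNorm_mul [NormSMulClass ℂ X] (hX : ∀ x : X, 0 ≤ ‖x‖) {a : X →ₗ[ℂ] ℂ}
    (ha : IsBoundedOperator a) (x : X) : ‖a x‖ ≤ functionalNorm a * ‖x‖ := by
  obtain ⟨C, hC⟩ := ha
  rcases (hX x).eq_or_lt with h | h
  · simpa only [← h, mul_zero] using hC x
  · have hb : BddAbove {r : ℝ | ∃ x : X, ‖x‖ ≤ 1 ∧ r = ‖a x‖} := by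
      refine ⟨|C|, ?_⟩
      rintro r ⟨z, hz, rfl⟩
      calc ‖a z‖ ≤ C * ‖z‖ := hC z
        _ ≤ |C| * ‖z‖ := mul_le_mul_of_nonneg_right (le_abs_self C) (hX z)
        _ ≤ |C| := mul_le_of_le_one_right (abs_nonneg C) hz
    have hnorm : ‖((‖x‖⁻¹ : ℝ) : ℂ)‖ = ‖x‖⁻¹ := by
      rw [Complex.norm_real, norm_inv, Real.norm_of_nonneg h.le]
    have hunit : ‖((‖x‖⁻¹ : ℝ) : ℂ) • x‖ ≤ 1 := by
      rw [norm_smul, hnorm, inv_mul_cancel₀ h.ne']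
    have hle : ‖a (((‖x‖⁻¹ : ℝ) : ℂ) • x)‖ ≤ functionalNorm a := le_csSup hb ⟨_, hunit, rfl⟩
    rwa [map_smul, norm_smul, hnorm, inv_mul_le_iff₀ h, mul_comm] at hle

theorem hasSum_coordinate [NormSMulClass ℂ X] (hX : ∀ x : X, 0 ≤ ‖x‖) {T : X →ₗ[ℂ] Y}
    {a : ℕ → X →ₗ[ℂ] ℂ} {y : ℕ → Y} (ha : ∀ j, IsBoundedOperator (a j))
    (hs : Summable fun j => functionalNorm (a j) * ‖y j‖) {x : X}
    (hT : Tendsto (fun N => ‖T x - ∑ j ∈ Finset.range N, a j x • y j‖) atTop (𝓝 0))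
    {f : Y →ₗ[ℂ] ℂ} (hf : IsBoundedOperator f) :
    HasSum (fun j => a j x * f (y j)) (f (T x)) := by
  obtain ⟨K, hK⟩ := hf
  have hsum : Summable fun j => a j x * f (y j) := by
    refine Summable.of_norm_bounded (hs.mul_right (‖x‖ * K)) fun j => ?_
    calc ‖a j x * f (y j)‖ ≤ (functionalNorm (a j) * ‖x‖) * (K * ‖y j‖) := by
          rw [norm_mul]
          exact mul_le_mul (norm_le_functionalNorm_mul hX (ha j) x) (hK _) (norm_nonneg _)
            (mul_nonneg (functionalNorm_nonneg _) (hX x))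
      _ = functionalNorm (a j) * ‖y j‖ * (‖x‖ * K) := by ring
  rw [hsum.hasSum_iff_tendsto_nat, tendsto_iff_norm_sub_tendsto_zero]
  refine squeeze_zero (fun _ => norm_nonneg _) (fun N => ?_)
    (by simpa only [mul_zero] using hT.const_mul K)
  have hmap : f (T x - ∑ j ∈ Finset.range N, a j x • y j) =
      f (T x) - ∑ j ∈ Finset.range N, a j x * f (y j) := by
    simp only [map_sub, map_sum, map_smul, smul_eq_mul]
  rw [norm_sub_rev, ← hmap]
  exact hK _

theorem exists_strictMono_forall_tendsto {u : ℕ → ℕ → ℂ} {c : ℕ → ℝ}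
    (hu : ∀ n j, ‖u n j‖ ≤ c j) :
    ∃ (l : ℕ → ℂ) (φ : ℕ → ℕ), StrictMono φ ∧
      ∀ j, Tendsto (fun n => u (φ n) j) atTop (𝓝 (l j)) := by
  have hcompact : IsCompact (Set.univ.pi fun j => Metric.closedBall (0 : ℂ) (c j)) :=
    isCompact_univ_pi fun j => isCompact_closedBall 0 (c j)
  obtain ⟨l, -, φ, hφ, hl⟩ := hcompact.tendsto_subseq (x := u)
    fun n j _ => mem_closedBall_zero_iff.2 (hu n j)
  exact ⟨l, φ, hφ, tendsto_pi_nhds.1 hl⟩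

/- Along a subsequence all `a_j (x_n)` converge, so that the series of
`f_n (T (x_{n+1} - x_n)) = -1` tends to `0` by dominated convergence. -/
theorem not_isNuclearOperator_of_biorthogonal [NormSMulClass ℂ X] (hX : ∀ x : X, 0 ≤ ‖x‖)
    {T : X →ₗ[ℂ] Y} {x : ℕ → X} {f : ℕ → Y →ₗ[ℂ] ℂ} {K : ℝ} (hx : ∀ n, ‖x n‖ ≤ 1)
    (hf : ∀ n z, ‖f n z‖ ≤ K * ‖z‖) (h0 : ∀ n n', n < n' → f n (T (x n')) = 0)
    (h1 : ∀ n, f n (T (x n)) = 1) : ¬ IsNuclearOperator T := by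
  rintro ⟨-, a, y, ha, hs, hlim⟩
  have hax (n j : ℕ) : ‖a j (x n)‖ ≤ functionalNorm (a j) :=
    (norm_le_functionalNorm_mul hX (ha j) _).trans
      (mul_le_of_le_one_right (functionalNorm_nonneg _) (hx n))
  obtain ⟨l, φ, hφ, hl⟩ := exists_strictMono_forall_tendsto hax
  set δ : ℕ → X := fun n => x (φ (n + 1)) - x (φ n)
  have hδ (n j : ℕ) : ‖a j (δ n)‖ ≤ 2 * functionalNorm (a j) := by
    rw [map_sub]
    exact (norm_sub_le _ _).trans (by linarith [hax (φ (n + 1)) j, hax (φ n) j])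
  have hδ_lim (j : ℕ) : Tendsto (fun n => a j (δ n)) atTop (𝓝 0) := by
    simpa only [δ, map_sub, sub_self] using ((tendsto_add_atTop_iff_nat 1).2 (hl j)).sub (hl j)
  have hsum (n : ℕ) : ∑' j, a j (δ n) * f (φ n) (y j) = -1 := by
    rw [(hasSum_coordinate hX ha hs (hlim _) ⟨K, hf (φ n)⟩).tsum_eq, map_sub, map_sub,
      h0 _ _ (hφ n.lt_succ_self), h1, zero_sub]
  have hterm (n j : ℕ) : ‖a j (δ n) * f (φ n) (y j)‖ ≤ ‖a j (δ n)‖ * (K * ‖y j‖) := by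
    rw [norm_mul]
    gcongr
    exact hf _ _
  have htends : Tendsto (fun n => ∑' j, a j (δ n) * f (φ n) (y j)) atTop (𝓝 (∑' _ : ℕ, 0)) := by
    refine tendsto_tsum_of_dominated_convergence (hs.mul_left (2 * K)) (fun j => ?_)
      (Eventually.of_forall fun n j => ?_)
    · refine squeeze_zero_norm (fun n => hterm n j) ?_
      simpa only [norm_zero, zero_mul] using (hδ_lim j).norm.mul_const (K * ‖y j‖)
    · calc ‖a j (δ n) * f (φ n) (y j)‖ ≤ ‖a j (δ n)‖ * (K * ‖y j‖) := hterm n j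
        _ ≤ 2 * functionalNorm (a j) * (K * ‖y j‖) :=
            mul_le_mul_of_nonneg_right (hδ n j) ((norm_nonneg _).trans (hf (φ n) (y j)))
        _ = 2 * K * (functionalNorm (a j) * ‖y j‖) := by ring
  simp_rw [hsum, tsum_zero] at htends
  exact neg_ne_zero.2 one_ne_zero (tendsto_nhds_unique tendsto_const_nhds htends)

/- Trace duality: the left-hand side is the trace of `T` composed with the operator
`z ↦ ∑ f_i(z) x_i` of finite rank. -/
theorem IsNuclearOperator.exists_trace_le [NormSMulClass ℂ X] (hX : ∀ x : X, 0 ≤ ‖x‖)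
    {T : X →ₗ[ℂ] Y} (hT : IsNuclearOperator T) :
    ∃ M : ℝ, ∀ {ι : Type*} (s : Finset ι) (x : ι → X) (f : ι → Y →ₗ[ℂ] ℂ) (K : ℝ),
      (∀ i, IsBoundedOperator (f i)) → (∀ z, ‖∑ i ∈ s, f i z • x i‖ ≤ K * ‖z‖) →
      ‖∑ i ∈ s, f i (T (x i))‖ ≤ M * K := by
  obtain ⟨-, a, y, ha, hs, hlim⟩ := hT
  refine ⟨∑' j, functionalNorm (a j) * ‖y j‖, fun s x f K hf hR => ?_⟩
  have hsum : HasSum (fun j => a j (∑ i ∈ s, f i (y j) • x i)) (∑ i ∈ s, f i (T (x i))) := by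
    refine (hasSum_sum fun i _ => hasSum_coordinate hX ha hs (hlim (x i)) (hf i)).congr_fun
      fun j => ?_
    simp only [map_sum, map_smul, smul_eq_mul, mul_comm]
  rw [← hsum.tsum_eq]
  refine tsum_of_norm_bounded (hs.hasSum.mul_right K) fun j => ?_
  calc ‖a j (∑ i ∈ s, f i (y j) • x i)‖
      ≤ functionalNorm (a j) * ‖∑ i ∈ s, f i (y j) • x i‖ :=
        norm_le_functionalNorm_mul hX (ha j) _
    _ ≤ functionalNorm (a j) * (K * ‖y j‖) :=
        mul_le_mul_of_nonneg_left (hR _) (functionalNorm_nonneg _)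
    _ = functionalNorm (a j) * ‖y j‖ * K := by ring

end NuclearOperator

section BesovSeqENorm

variable {m : ℕ} {w : (Fin m → ℝ) → ℝ} {σ : ℝ} {p q : ℝ≥0∞}

/-- The contribution `2^{νσ} (∑_k |v_k|^p 2^{mν} w(Q_{ν,k}))^{1/p}` of the level `ν` to the
quasi-norm of `b^σ_{p,q}(w)`. -/
noncomputable def besovLevelENorm (w : (Fin m → ℝ) → ℝ) (σ : ℝ) (p : ℝ≥0∞) (ν : ℕ)
    (v : (Fin m → ℤ) → ℂ) : ℝ≥0∞ :=
  2 ^ (ν * σ) * weightedLpNorm p (cubeMean w ν) fun k => ‖v k‖ₑ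

/-- The quasi-norm in `b^σ_{p,q}(w)` of the sequence with the single nonzero entry `1` at
`(ν, k)`. -/
noncomputable def unitSeqENorm (w : (Fin m → ℝ) → ℝ) (σ : ℝ) (p : ℝ≥0∞) (ν : ℕ)
    (k : Fin m → ℤ) : ℝ≥0∞ :=
  2 ^ (ν * σ) * cubeMean w ν k ^ (p⁻¹).toReal

theorem besovSeqENorm_eq (w : (Fin m → ℝ) → ℝ) (σ : ℝ) (p q : ℝ≥0∞) (x : ℕ → (Fin m → ℤ) → ℂ) :
    besovSeqENorm w σ p q x =
      weightedLpNorm q (fun _ => 1) fun ν => besovLevelENorm w σ p ν (x ν) := rfl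

theorem besovLevelENorm_const_smul (hp : p ≠ 0) (ν : ℕ) (c : ℂ) (v : (Fin m → ℤ) → ℂ) :
    besovLevelENorm w σ p ν (c • v) = ‖c‖ₑ * besovLevelENorm w σ p ν v := by
  simp only [besovLevelENorm, Pi.smul_apply, smul_eq_mul, enorm_mul]
  rw [weightedLpNorm_const_mul hp, mul_left_comm]

theorem besovLevelENorm_zero (hp : p ≠ 0) (ν : ℕ) : besovLevelENorm w σ p ν 0 = 0 := by
  simp only [besovLevelENorm, Pi.zero_apply, enorm_zero, weightedLpNorm_zero hp, mul_zero]

theorem besovLevelENorm_single (hp : p ≠ 0) (ν : ℕ) (k : Fin m → ℤ) (c : ℂ) :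
    besovLevelENorm w σ p ν (Pi.single k c) = ‖c‖ₑ * unitSeqENorm w σ p ν k := by
  rw [besovLevelENorm, unitSeqENorm, mul_left_comm, weightedLpNorm_eq_of_support hp _ _ k
    fun j hj => by rw [Pi.single_eq_of_ne hj, enorm_zero], Pi.single_eq_same]

theorem enorm_mul_unitSeqENorm_le (hp : p ≠ 0) (ν : ℕ) (v : (Fin m → ℤ) → ℂ) (k : Fin m → ℤ) :
    ‖v k‖ₑ * unitSeqENorm w σ p ν k ≤ besovLevelENorm w σ p ν v := by
  rw [besovLevelENorm, unitSeqENorm, mul_left_comm]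
  gcongr
  exact mul_rpow_le_weightedLpNorm hp (cubeMean w ν) (fun k => ‖v k‖ₑ) k

theorem besovSeqENorm_smul (hp : p ≠ 0) (hq : q ≠ 0) (c : ℂ) (x : ℕ → (Fin m → ℤ) → ℂ) :
    besovSeqENorm w σ p q (c • x) = ‖c‖ₑ * besovSeqENorm w σ p q x := by
  simp only [besovSeqENorm_eq, Pi.smul_apply, besovLevelENorm_const_smul hp,
    weightedLpNorm_const_mul hq]

theorem besovLevelENorm_le_besovSeqENorm (hq : q ≠ 0) (x : ℕ → (Fin m → ℤ) → ℂ) (ν : ℕ) :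
    besovLevelENorm w σ p ν (x ν) ≤ besovSeqENorm w σ p q x := by
  simpa only [ENNReal.one_rpow, mul_one, besovSeqENorm_eq] using
    mul_rpow_le_weightedLpNorm hq (fun _ => 1) (fun ν => besovLevelENorm w σ p ν (x ν)) ν

theorem besovSeqENorm_single (hp : p ≠ 0) (hq : q ≠ 0) (ν : ℕ) (v : (Fin m → ℤ) → ℂ) :
    besovSeqENorm w σ p q (Pi.single ν v) = besovLevelENorm w σ p ν v := by
  rw [besovSeqENorm_eq, weightedLpNorm_eq_of_support hq _ _ ν fun j hj => by
    rw [Pi.single_eq_of_ne hj, besovLevelENorm_zero hp], Pi.single_eq_same, ENNReal.one_rpow,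
    mul_one]

theorem unitSeqENorm_ne_top {ν : ℕ} {k : Fin m → ℤ} (hw : cubeMean w ν k ≠ ∞) :
    unitSeqENorm w σ p ν k ≠ ∞ :=
  ENNReal.mul_ne_top (two_rpow_ne_top _) (ENNReal.rpow_ne_top_of_nonneg ENNReal.toReal_nonneg hw)

theorem unitSeqENorm_ne_zero {ν : ℕ} {k : Fin m → ℤ} (hw₀ : cubeMean w ν k ≠ 0)
    (hw : cubeMean w ν k ≠ ∞) : unitSeqENorm w σ p ν k ≠ 0 :=
  mul_ne_zero (two_rpow_ne_zero _) (ENNReal.rpow_pos (pos_iff_ne_zero.2 hw₀) hw).ne'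

theorem besovSeqENorm_single_mul_le {p₁ p₂ q₁ q₂ : ℝ≥0∞} (hp₁ : p₁ ≠ 0) (hp₂ : p₂ ≠ 0)
    (hq₁ : q₁ ≠ 0) (hq₂ : q₂ ≠ 0) {σ₁ σ₂ t : ℝ} (ht : 0 < t)
    (hpt : (p₁⁻¹).toReal = t + (p₂⁻¹).toReal) (ν : ℕ) (ρ : (Fin m → ℤ) → ℂ)
    (x : ℕ → (Fin m → ℤ) → ℂ) :
    besovSeqENorm w σ₁ p₁ q₁ (Pi.single ν (ρ * x ν)) ≤
      2 ^ (ν * (σ₁ - σ₂)) * (∑' k, ‖ρ k‖ₑ ^ (1 / t) * cubeMean w ν k) ^ t *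
        besovSeqENorm w σ₂ p₂ q₂ x := by
  rw [besovSeqENorm_single hp₁ hq₁, besovLevelENorm]
  simp only [Pi.mul_apply, enorm_mul]
  calc 2 ^ (ν * σ₁) * weightedLpNorm p₁ (cubeMean w ν) (fun k => ‖ρ k‖ₑ * ‖x ν k‖ₑ)
      ≤ 2 ^ (ν * (σ₁ - σ₂) + ν * σ₂) * ((∑' k, ‖ρ k‖ₑ ^ (1 / t) * cubeMean w ν k) ^ t *
          weightedLpNorm p₂ (cubeMean w ν) fun k => ‖x ν k‖ₑ) := by
        rw [← mul_add, sub_add_cancel]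
        gcongr
        exact weightedLpNorm_mul_le_Lp_mul_Lq hp₁ hp₂ ht hpt _ _ _
    _ = 2 ^ (ν * (σ₁ - σ₂)) * (∑' k, ‖ρ k‖ₑ ^ (1 / t) * cubeMean w ν k) ^ t *
          besovLevelENorm w σ₂ p₂ ν (x ν) := by
        rw [two_rpow_add, besovLevelENorm]
        ring
    _ ≤ _ := by
        gcongr
        exact besovLevelENorm_le_besovSeqENorm hq₂ x ν

end BesovSeqENorm

section BesovSeq

variable {m : ℕ} {w : (Fin m → ℝ) → ℝ} {σ : ℝ} {p q : ℝ≥0∞} {hp : 0 < p} {hq : 0 < q}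

theorem BesovSeq.norm_def (x : BesovSeq w σ p q hp hq) :
    ‖x‖ = (besovSeqENorm w σ p q (x : ℕ → (Fin m → ℤ) → ℂ)).toReal := rfl

theorem BesovSeq.zero_le_norm (x : BesovSeq w σ p q hp hq) : 0 ≤ ‖x‖ := ENNReal.toReal_nonneg

instance BesovSeq.instNormSMulClass : NormSMulClass ℂ (BesovSeq w σ p q hp hq) where
  norm_smul c x := by
    rw [BesovSeq.norm_def, BesovSeq.norm_def, Submodule.coe_smul, besovSeqENorm_smul hp.ne' hq.ne',
      ENNReal.toReal_mul, toReal_enorm]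

/-- The coordinate functional `x ↦ x_{ν,k}` on `b^σ_{p,q}(w)`. -/
def BesovSeq.coord (ν : ℕ) (k : Fin m → ℤ) : BesovSeq w σ p q hp hq →ₗ[ℂ] ℂ :=
  LinearMap.proj k ∘ₗ LinearMap.proj (φ := fun _ => (Fin m → ℤ) → ℂ) ν ∘ₗ Submodule.subtype _

@[simp]
theorem BesovSeq.coord_apply (ν : ℕ) (k : Fin m → ℤ) (x : BesovSeq w σ p q hp hq) :
    BesovSeq.coord ν k x = (x : ℕ → (Fin m → ℤ) → ℂ) ν k := rfl

theorem BesovSeq.norm_coord_mul_le (ν : ℕ) (k : Fin m → ℤ) (x : BesovSeq w σ p q hp hq) :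
    ‖BesovSeq.coord ν k x‖ * (unitSeqENorm w σ p ν k).toReal ≤ ‖x‖ := by
  rw [BesovSeq.norm_def, ← toReal_enorm, ← ENNReal.toReal_mul]
  exact ENNReal.toReal_mono x.2.ne ((enorm_mul_unitSeqENorm_le hp.ne' ν _ k).trans
    (besovLevelENorm_le_besovSeqENorm hq.ne' _ ν))

theorem BesovSeq.isBoundedOperator_coord {ν : ℕ} {k : Fin m → ℤ} (hw₀ : cubeMean w ν k ≠ 0)
    (hw : cubeMean w ν k ≠ ∞) :
    IsBoundedOperator (BesovSeq.coord ν k : BesovSeq w σ p q hp hq →ₗ[ℂ] ℂ) := by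
  have hpos := ENNReal.toReal_pos (unitSeqENorm_ne_zero (σ := σ) (p := p) hw₀ hw)
    (unitSeqENorm_ne_top hw)
  refine ⟨(unitSeqENorm w σ p ν k).toReal⁻¹, fun x => ?_⟩
  rw [le_inv_mul_iff₀ hpos, mul_comm]
  exact BesovSeq.norm_coord_mul_le ν k x

/-- The multiple `c e_{ν,k}` of a unit sequence, as an element of `b^σ_{p,q}(w)`. -/
def BesovSeq.single (ν : ℕ) (k : Fin m → ℤ) (hw : cubeMean w ν k ≠ ∞) (c : ℂ) :
    BesovSeq w σ p q hp hq :=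
  ⟨Pi.single ν (Pi.single k c), by
    change besovSeqENorm w σ p q _ < ∞
    rw [besovSeqENorm_single hp.ne' hq.ne', besovLevelENorm_single hp.ne']
    exact ENNReal.mul_lt_top enorm_lt_top (unitSeqENorm_ne_top hw).lt_top⟩

@[simp]
theorem BesovSeq.coe_single (ν : ℕ) (k : Fin m → ℤ) (hw : cubeMean w ν k ≠ ∞) (c : ℂ) :
    ((BesovSeq.single ν k hw c : BesovSeq w σ p q hp hq) : ℕ → (Fin m → ℤ) → ℂ) =
      Pi.single ν (Pi.single k c) := rfl

theorem BesovSeq.norm_single (ν : ℕ) (k : Fin m → ℤ) (hw : cubeMean w ν k ≠ ∞) (c : ℂ) :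
    ‖(BesovSeq.single ν k hw c : BesovSeq w σ p q hp hq)‖ =
      ‖c‖ * (unitSeqENorm w σ p ν k).toReal := by
  rw [BesovSeq.norm_def, BesovSeq.coe_single, besovSeqENorm_single hp.ne' hq.ne',
    besovLevelENorm_single hp.ne', ENNReal.toReal_mul, toReal_enorm]

end BesovSeq

section SizeSeries

theorem tsum_two_rpow_nat_mul_ne_top_iff {θ : ℝ} :
    ∑' ν : ℕ, (2 : ℝ≥0∞) ^ (ν * θ) ≠ ∞ ↔ θ < 0 := by
  have hpow (ν : ℕ) : (2 : ℝ≥0∞) ^ (ν * θ) = (2 ^ θ) ^ ν := by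
    rw [mul_comm, ENNReal.rpow_mul, ENNReal.rpow_natCast]
  rw [tsum_congr hpow, ENNReal.tsum_geometric, Ne, ENNReal.inv_eq_top, tsub_eq_zero_iff_le, not_le]
  constructor
  · contrapose!
    intro h
    simpa only [ENNReal.rpow_zero] using two_rpow_le_two_rpow h
  · exact ENNReal.rpow_lt_one_of_one_lt_of_neg ENNReal.one_lt_two

/-- The integers `k` whose absolute value has binary length `j`, that is, `k = 0` for `j = 0` and
`2^{j-1} ≤ |k| < 2^j` for `j ≥ 1`. -/
noncomputable def sizeBlock (j : ℕ) : Finset ℤ :=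
  (Finset.Ioo (-2 ^ j) (2 ^ j)).filter fun k => Nat.size k.natAbs = j

theorem size_natAbs_le_iff {j : ℕ} {k : ℤ} :
    Nat.size k.natAbs ≤ j ↔ k ∈ Finset.Ioo (-2 ^ j : ℤ) (2 ^ j) := by
  rw [Nat.size_le, Finset.mem_Ioo, ← abs_lt, ← Int.natCast_natAbs]
  norm_cast

theorem mem_sizeBlock {j : ℕ} {k : ℤ} : k ∈ sizeBlock j ↔ Nat.size k.natAbs = j := by
  rw [sizeBlock, Finset.mem_filter, ← size_natAbs_le_iff]
  exact and_iff_right_of_imp le_of_eq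

theorem card_sizeBlock (j : ℕ) : (sizeBlock j).card = 2 ^ j := by
  rcases j with _ | j
  · rfl
  · have hsdiff : sizeBlock (j + 1) =
        Finset.Ioo (-2 ^ (j + 1) : ℤ) (2 ^ (j + 1)) \ Finset.Ioo (-2 ^ j) (2 ^ j) := by
      ext k
      rw [mem_sizeBlock, Finset.mem_sdiff, ← size_natAbs_le_iff, ← size_natAbs_le_iff, not_le,
        le_antisymm_iff, Nat.succ_le_iff]
    have hsub : Finset.Ioo (-2 ^ j : ℤ) (2 ^ j) ⊆ Finset.Ioo (-2 ^ (j + 1)) (2 ^ (j + 1)) :=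
      fun k hk => size_natAbs_le_iff.1 ((size_natAbs_le_iff.2 hk).trans j.le_succ)
    have hpow : (1 : ℤ) ≤ 2 ^ j := one_le_pow₀ one_le_two
    rw [hsdiff, Finset.card_sdiff_of_subset hsub, Int.card_Ioo, Int.card_Ioo]
    zify
    rw [pow_succ]
    omega

theorem tsum_comp_size (g : ℕ → ℝ≥0∞) :
    ∑' k : ℤ, g (Nat.size k.natAbs) = ∑' j : ℕ, 2 ^ j * g j := by
  rw [← ENNReal.tsum_fiberwise _ fun k : ℤ => Nat.size k.natAbs]
  refine tsum_congr fun j => ?_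
  have hpre : (fun k : ℤ => Nat.size k.natAbs) ⁻¹' {j} = sizeBlock j :=
    Set.ext fun k => mem_sizeBlock.symm
  rw [hpre, Finset.tsum_subtype' (sizeBlock j) fun k : ℤ => g (Nat.size k.natAbs),
    Finset.sum_congr rfl fun k hk => by rw [mem_sizeBlock.1 hk], Finset.sum_const, card_sizeBlock,
    nsmul_eq_mul, Nat.cast_pow, Nat.cast_ofNat]

theorem tsum_two_rpow_neg_mul_size_ne_top_iff {a : ℝ} :
    ∑' k : ℤ, (2 : ℝ≥0∞) ^ (-(a * Nat.size k.natAbs)) ≠ ∞ ↔ 1 < a := by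
  rw [tsum_comp_size fun j => (2 : ℝ≥0∞) ^ (-(a * j)), ← sub_neg,
    ← tsum_two_rpow_nat_mul_ne_top_iff]
  have hterm (j : ℕ) : (2 : ℝ≥0∞) ^ j * 2 ^ (-(a * j)) = 2 ^ (j * (1 - a)) := by
    rw [← ENNReal.rpow_natCast, ← two_rpow_add]
    ring_nf
  rw [tsum_congr hterm]

theorem tsum_pi_prod {ι : Type*} {m : ℕ} (f : Fin m → ι → ℝ≥0∞) :
    ∑' k : Fin m → ι, ∏ i, f i (k i) = ∏ i, ∑' j, f i j := by
  induction m with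
  | zero =>
    rw [tsum_eq_single default fun k hk => absurd (Subsingleton.elim k _) hk]
    simp only [Finset.univ_eq_empty, Finset.prod_empty]
  | succ m ih =>
    rw [← (Fin.consEquiv fun _ : Fin (m + 1) => ι).tsum_eq, ENNReal.tsum_prod', Fin.prod_univ_succ,
      ← ih, ← ENNReal.tsum_mul_right]
    refine tsum_congr fun a => ?_
    rw [← ENNReal.tsum_mul_left]
    refine tsum_congr fun b => ?_
    simp only [Fin.consEquiv_apply, Fin.prod_univ_succ, Fin.cons_zero, Fin.cons_succ]

end SizeSeries

section Necessity

variable {m : ℕ} {w : (Fin m → ℝ) → ℝ} {γ : Fin m → ℕ} {p₁ p₂ q₁ q₂ : ℝ≥0∞} {hp₁ : 0 < p₁}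
  {hp₂ : 0 < p₂} {hq₁ : 0 < q₁} {hq₂ : 0 < q₂} {σ₁ σ₂ : ℝ}

theorem not_idIsNuclear_of_unitSeqENorm_le {α : ℕ → ℕ × (Fin m → ℤ)} (hα : Function.Injective α)
    (hw₀ : ∀ n, cubeMean w (α n).1 (α n).2 ≠ 0) (hw : ∀ n, cubeMean w (α n).1 (α n).2 ≠ ∞)
    {C : ℝ≥0∞} (hC : C ≠ ∞)
    (h : ∀ n, unitSeqENorm w σ₁ p₁ (α n).1 (α n).2 ≤ C * unitSeqENorm w σ₂ p₂ (α n).1 (α n).2) :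
    ¬ IdIsNuclear (BesovSeq w σ₁ p₁ q₁ hp₁ hq₁) (BesovSeq w σ₂ p₂ q₂ hp₂ hq₂) := by
  rintro ⟨hle, hT⟩
  set r : ℕ → ℝ := fun n => (unitSeqENorm w σ₁ p₁ (α n).1 (α n).2).toReal
  have hr (n : ℕ) : 0 < r n :=
    ENNReal.toReal_pos (unitSeqENorm_ne_zero (hw₀ n) (hw n)) (unitSeqENorm_ne_top (hw n))
  have hrC (n : ℕ) : r n ≤ C.toReal * (unitSeqENorm w σ₂ p₂ (α n).1 (α n).2).toReal := by
    rw [← ENNReal.toReal_mul]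
    exact ENNReal.toReal_mono (ENNReal.mul_ne_top hC (unitSeqENorm_ne_top (hw n))) (h n)
  refine not_isNuclearOperator_of_biorthogonal BesovSeq.zero_le_norm (K := C.toReal)
    (x := fun n => BesovSeq.single (α n).1 (α n).2 (hw n) ((r n)⁻¹ : ℝ))
    (f := fun n => (r n : ℂ) • BesovSeq.coord (α n).1 (α n).2)
    (fun n => ?_) (fun n z => ?_) (fun n n' hn => ?_) (fun n => ?_) hT
  · rw [BesovSeq.norm_single, Complex.norm_real, norm_inv, Real.norm_of_nonneg (hr n).le]
    exact (inv_mul_cancel₀ (hr n).ne').le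
  · rw [LinearMap.smul_apply, norm_smul, Complex.norm_real, Real.norm_of_nonneg (hr n).le]
    calc r n * ‖BesovSeq.coord (α n).1 (α n).2 z‖
        ≤ C.toReal * (unitSeqENorm w σ₂ p₂ (α n).1 (α n).2).toReal *
          ‖BesovSeq.coord (α n).1 (α n).2 z‖ := by gcongr; exact hrC n
      _ = C.toReal * (‖BesovSeq.coord (α n).1 (α n).2 z‖ *
          (unitSeqENorm w σ₂ p₂ (α n).1 (α n).2).toReal) := by ring
      _ ≤ C.toReal * ‖z‖ := by gcongr; exact BesovSeq.norm_coord_mul_le _ _ z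
  · simp only [LinearMap.smul_apply, BesovSeq.coord_apply, Submodule.coe_inclusion,
      BesovSeq.coe_single]
    by_cases hν : (α n).1 = (α n').1
    · have hk : (α n).2 ≠ (α n').2 := fun hk => hn.ne (hα (Prod.ext hν hk))
      rw [hν, Pi.single_eq_same, Pi.single_eq_of_ne hk, smul_zero]
    · rw [Pi.single_eq_of_ne hν, Pi.zero_apply, smul_zero]
  · simp only [LinearMap.smul_apply, BesovSeq.coord_apply, Submodule.coe_inclusion,
      BesovSeq.coe_single, Pi.single_eq_same, smul_eq_mul]
    rw [← Complex.ofReal_mul, mul_inv_cancel₀ (hr n).ne', Complex.ofReal_one]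

theorem not_idIsNuclear_of_weightExponent_le (hγ : ∀ i, 1 ≤ γ i) {α : ℕ → ℕ × (Fin m → ℤ)}
    (hα : Function.Injective α)
    (h : ∀ n, (α n).1 * (σ₁ - σ₂) +
      weightExponent γ (α n).1 (α n).2 * ((p₁⁻¹).toReal - (p₂⁻¹).toReal) ≤ 0) :
    ¬ IdIsNuclear (BesovSeq (blockWeight γ) σ₁ p₁ q₁ hp₁ hq₁)
      (BesovSeq (blockWeight γ) σ₂ p₂ q₂ hp₂ hq₂) := by
  refine not_idIsNuclear_of_unitSeqENorm_le hα (fun _ => cubeMean_blockWeight_ne_zero hγ _ _)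
    (fun _ => cubeMean_blockWeight_ne_top hγ _ _)
    (two_rpow_ne_top (2 * (∑ i, (γ i : ℝ)) * (p₂⁻¹).toReal)) fun n => ?_
  have hn := h n
  generalize (α n).1 = ν, (α n).2 = k at hn ⊢
  set c : ℝ := 2 * ∑ i, (γ i : ℝ)
  calc 2 ^ (ν * σ₁) * cubeMean (blockWeight γ) ν k ^ (p₁⁻¹).toReal
      ≤ 2 ^ (ν * σ₁) * (2 ^ weightExponent γ ν k) ^ (p₁⁻¹).toReal := by
        gcongr
        exact cubeMean_blockWeight_le hγ ν k
    _ ≤ 2 ^ (c * (p₂⁻¹).toReal) *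
          (2 ^ (ν * σ₂) * (2 ^ (weightExponent γ ν k - c)) ^ (p₂⁻¹).toReal) := by
        simp only [← ENNReal.rpow_mul, ← two_rpow_add]
        exact two_rpow_le_two_rpow (by linarith)
    _ ≤ 2 ^ (c * (p₂⁻¹).toReal) *
          (2 ^ (ν * σ₂) * cubeMean (blockWeight γ) ν k ^ (p₂⁻¹).toReal) := by
        gcongr
        exact le_cubeMean_blockWeight hγ ν k

theorem weightExponent_zero_right (ν : ℕ) :
    weightExponent γ ν 0 = -(ν * ∑ i, ((γ i : ℝ) - 1)) := by
  rw [weightExponent, Finset.mul_sum, ← Finset.sum_neg_distrib]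
  refine Finset.sum_congr rfl fun i _ => ?_
  rw [Pi.zero_apply, Int.natAbs_zero, Nat.size_zero, Nat.cast_zero]
  ring

theorem weightExponent_zero_single (i : Fin m) (k : ℤ) :
    weightExponent γ 0 (Pi.single i k) = ((γ i : ℝ) - 1) * Nat.size k.natAbs := by
  rw [weightExponent, Finset.sum_eq_single_of_mem i (Finset.mem_univ i), Pi.single_eq_same,
    Nat.cast_zero, sub_zero]
  intro j _ hj
  rw [Pi.single_eq_of_ne hj, Int.natAbs_zero, Nat.size_zero, Nat.cast_zero, sub_zero, mul_zero]

theorem sum_sub_one_mul_lt_of_idIsNuclear (hγ : ∀ i, 1 ≤ γ i)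
    (h : IdIsNuclear (BesovSeq (blockWeight γ) σ₁ p₁ q₁ hp₁ hq₁)
      (BesovSeq (blockWeight γ) σ₂ p₂ q₂ hp₂ hq₂)) :
    (∑ i, ((γ i : ℝ) - 1)) * ((p₁⁻¹).toReal - (p₂⁻¹).toReal) < σ₁ - σ₂ := by
  by_contra! hcon
  refine not_idIsNuclear_of_weightExponent_le hγ (α := fun n => (n, 0))
    (Prod.mk_left_injective 0) (fun n => ?_) h
  rw [weightExponent_zero_right, neg_mul, mul_assoc, ← sub_eq_add_neg, ← mul_sub]
  exact mul_nonpos_of_nonneg_of_nonpos n.cast_nonneg (sub_nonpos.2 hcon)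

theorem sub_one_mul_pos_of_idIsNuclear (hγ : ∀ i, 1 ≤ γ i)
    (h : IdIsNuclear (BesovSeq (blockWeight γ) σ₁ p₁ q₁ hp₁ hq₁)
      (BesovSeq (blockWeight γ) σ₂ p₂ q₂ hp₂ hq₂)) (i : Fin m) :
    0 < ((γ i : ℝ) - 1) * ((p₁⁻¹).toReal - (p₂⁻¹).toReal) := by
  by_contra! hcon
  have hinj : Function.Injective fun n : ℕ => (0, (Pi.single i (n : ℤ) : Fin m → ℤ)) :=
    (Prod.mk_right_injective 0).comp ((Pi.single_injective i).comp Nat.cast_injective)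
  refine not_idIsNuclear_of_weightExponent_le hγ hinj (fun n => ?_) h
  rw [weightExponent_zero_single, Nat.cast_zero, zero_mul, zero_add, mul_right_comm]
  exact mul_nonpos_of_nonpos_of_nonneg hcon (Nat.cast_nonneg _)

theorem BesovSeq.coe_sum_coord_smul_single {ν : ℕ} (hw : ∀ k, cubeMean w ν k ≠ ∞)
    (S : Finset (Fin m → ℤ)) (ρ : (Fin m → ℤ) → ℂ) (z : BesovSeq w σ₂ p₂ q₂ hp₂ hq₂) :
    ((∑ k ∈ S, BesovSeq.coord ν k z • BesovSeq.single ν k (hw k) (ρ k) :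
      BesovSeq w σ₁ p₁ q₁ hp₁ hq₁) : ℕ → (Fin m → ℤ) → ℂ) =
      Pi.single ν ((S : Set (Fin m → ℤ)).indicator ρ * (z : ℕ → (Fin m → ℤ) → ℂ) ν) := by
  classical
  ext ν' k'
  simp only [Submodule.coe_sum, Submodule.coe_smul, BesovSeq.coe_single, BesovSeq.coord_apply,
    Finset.sum_apply, Pi.smul_apply]
  rcases eq_or_ne ν' ν with rfl | hν
  · simp only [Pi.single_eq_same, Pi.single_apply, smul_eq_mul, mul_ite,
      Finset.sum_ite_eq, Pi.mul_apply, Set.indicator_apply, Finset.mem_coe, zero_mul, mul_comm]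
  · simp only [Pi.single_eq_of_ne hν, Pi.zero_apply, smul_zero, Finset.sum_const_zero]

theorem exists_sum_le_mul_sum_rpow_of_idIsNuclear {ν : ℕ} (hw₀ : ∀ k, cubeMean w ν k ≠ 0)
    (hw : ∀ k, cubeMean w ν k ≠ ∞) {t : ℝ} (ht : 0 < t)
    (hpt : (p₁⁻¹).toReal = t + (p₂⁻¹).toReal)
    (h : IdIsNuclear (BesovSeq w σ₁ p₁ q₁ hp₁ hq₁) (BesovSeq w σ₂ p₂ q₂ hp₂ hq₂)) :
    ∃ M : ℝ≥0∞, M ≠ ∞ ∧ ∀ (S : Finset (Fin m → ℤ)) (ρ : (Fin m → ℤ) → NNReal),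
      (∑ k ∈ S, ρ k : ℝ≥0∞) ≤ M * (∑ k ∈ S, (ρ k : ℝ≥0∞) ^ (1 / t) * cubeMean w ν k) ^ t := by
  obtain ⟨hle, hT⟩ := h
  obtain ⟨M, hM⟩ := hT.exists_trace_le BesovSeq.zero_le_norm
  refine ⟨ENNReal.ofReal M * 2 ^ (ν * (σ₁ - σ₂)),
    ENNReal.mul_ne_top ENNReal.ofReal_ne_top (two_rpow_ne_top _), fun S ρ => ?_⟩
  set N : ℝ≥0∞ := ∑ k ∈ S, (ρ k : ℝ≥0∞) ^ (1 / t) * cubeMean w ν k with hN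
  have ht' : 0 < 1 / t := one_div_pos.2 ht
  have hK : 2 ^ (ν * (σ₁ - σ₂)) * N ^ t ≠ ∞ :=
    ENNReal.mul_ne_top (two_rpow_ne_top _) <| ENNReal.rpow_ne_top_of_nonneg ht.le <|
      ENNReal.sum_ne_top.2 fun k _ => ENNReal.mul_ne_top
        (ENNReal.rpow_ne_top_of_nonneg ht'.le ENNReal.coe_ne_top) (hw k)
  have hsum : ∑' k, ‖(S : Set (Fin m → ℤ)).indicator (fun k => (ρ k : ℂ)) k‖ₑ ^ (1 / t) *
      cubeMean w ν k = N := by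
    rw [hN, tsum_eq_sum (s := S) fun k hk => by
      rw [Set.indicator_of_notMem hk, enorm_zero, ENNReal.zero_rpow_of_pos ht', zero_mul]]
    refine Finset.sum_congr rfl fun k hk => ?_
    rw [Set.indicator_of_mem (Finset.mem_coe.2 hk), enorm_eq_nnnorm, Complex.nnnorm_real,
      NNReal.nnnorm_eq]
  have htrace := hM S (fun k => BesovSeq.single ν k (hw k) (ρ k : ℂ)) (BesovSeq.coord ν)
    (2 ^ (ν * (σ₁ - σ₂)) * N ^ t).toReal
    (fun k => BesovSeq.isBoundedOperator_coord (hw₀ k) (hw k)) fun z => by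
      rw [BesovSeq.norm_def, BesovSeq.norm_def, ← ENNReal.toReal_mul,
        BesovSeq.coe_sum_coord_smul_single, ← hsum]
      exact ENNReal.toReal_mono (ENNReal.mul_ne_top (hsum ▸ hK) z.2.ne) <|
        besovSeqENorm_single_mul_le hp₁.ne' hp₂.ne' hq₁.ne' hq₂.ne' ht hpt ν _ _
  simp only [BesovSeq.coord_apply, Submodule.coe_inclusion, BesovSeq.coe_single,
    Pi.single_eq_same] at htrace
  rw [← Complex.ofReal_sum, Complex.norm_real, Real.norm_of_nonneg
    (Finset.sum_nonneg fun k _ => (ρ k).coe_nonneg), ← NNReal.coe_sum] at htrace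
  rw [mul_assoc, ← ENNReal.ofReal_toReal hK, ← ENNReal.ofReal_mul' ENNReal.toReal_nonneg,
    ← ENNReal.ofNNReal_finsetSum, ← ENNReal.ofReal_coe_nnreal]
  exact ENNReal.ofReal_le_ofReal htrace

theorem le_rpow_of_le_mul_rpow {A M : ℝ≥0∞} {t : ℝ} (ht : t < 1) (hA : A ≠ ∞)
    (h : A ≤ M * A ^ t) : A ≤ M ^ (1 - t)⁻¹ := by
  rcases eq_or_ne A 0 with rfl | hA₀
  · exact zero_le
  have hpow : A ^ (1 - t) ≤ M := by
    rw [ENNReal.rpow_sub _ _ hA₀ hA, ENNReal.rpow_one]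
    exact ENNReal.div_le_of_le_mul h
  calc A = (A ^ (1 - t)) ^ (1 - t)⁻¹ := by
        rw [← ENNReal.rpow_mul, mul_inv_cancel₀ (sub_pos.2 ht).ne', ENNReal.rpow_one]
    _ ≤ M ^ (1 - t)⁻¹ := ENNReal.rpow_le_rpow hpow (inv_nonneg.2 (sub_pos.2 ht).le)

theorem tsum_cubeMean_rpow_ne_top_of_idIsNuclear {ν : ℕ} (hw₀ : ∀ k, cubeMean w ν k ≠ 0)
    (hw : ∀ k, cubeMean w ν k ≠ ∞) {t : ℝ} (ht : 0 < t) (ht₁ : t < 1)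
    (hpt : (p₁⁻¹).toReal = t + (p₂⁻¹).toReal)
    (h : IdIsNuclear (BesovSeq w σ₁ p₁ q₁ hp₁ hq₁) (BesovSeq w σ₂ p₂ q₂ hp₂ hq₂)) :
    ∑' k, cubeMean w ν k ^ (-(t / (1 - t))) ≠ ∞ := by
  obtain ⟨M, hM, hsum⟩ := exists_sum_le_mul_sum_rpow_of_idIsNuclear hw₀ hw ht hpt h
  have hne (k : Fin m → ℤ) : cubeMean w ν k ^ (-(t / (1 - t))) ≠ ∞ :=
    ENNReal.rpow_ne_top_of_ne_zero (hw₀ k) (hw k)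
  -- The extremal choice in Hölder's inequality: `ρ ^ (1 / t) * cubeMean = ρ`.
  have hρ (k : Fin m → ℤ) :
      (cubeMean w ν k ^ (-(t / (1 - t)))) ^ (1 / t) * cubeMean w ν k =
        cubeMean w ν k ^ (-(t / (1 - t))) := by
    have hexp : -(t / (1 - t)) * (1 / t) + 1 = -(t / (1 - t)) := by
      have := (sub_pos.2 ht₁).ne'
      field_simp
      ring
    rw [← ENNReal.rpow_mul]
    nth_rw 2 [← ENNReal.rpow_one (cubeMean w ν k)]
    rw [← ENNReal.rpow_add _ _ (hw₀ k) (hw k), hexp]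
  refine ne_top_of_le_ne_top (ENNReal.rpow_ne_top_of_nonneg
    (inv_nonneg.2 (sub_pos.2 ht₁).le) hM) ?_
  rw [ENNReal.tsum_eq_iSup_sum]
  refine iSup_le fun S => le_rpow_of_le_mul_rpow ht₁ (ENNReal.sum_ne_top.2 fun k _ => hne k) ?_
  simpa only [ENNReal.coe_toNNReal (hne _), hρ] using
    hsum S fun k => (cubeMean w ν k ^ (-(t / (1 - t)))).toNNReal

theorem one_lt_mul_of_idIsNuclear (hγ : ∀ i, 1 ≤ γ i)
    (h : IdIsNuclear (BesovSeq (blockWeight γ) σ₁ p₁ q₁ hp₁ hq₁)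
      (BesovSeq (blockWeight γ) σ₂ p₂ q₂ hp₂ hq₂)) (i : Fin m) :
    1 < ((p₁⁻¹).toReal - (p₂⁻¹).toReal) * γ i := by
  have hpos := sub_one_mul_pos_of_idIsNuclear hγ h i
  have hγ₁ : (1 : ℝ) ≤ γ i := Nat.one_le_cast.2 (hγ i)
  have hγi : 0 < (γ i : ℝ) - 1 := (sub_nonneg.2 hγ₁).lt_of_ne' (left_ne_zero_of_mul hpos.ne')
  set t := (p₁⁻¹).toReal - (p₂⁻¹).toReal
  have ht : 0 < t := pos_of_mul_pos_right hpos hγi.le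
  rcases le_or_gt 1 t with ht₁ | ht₁
  · exact one_lt_mul_of_le_of_lt ht₁ (sub_pos.1 hγi)
  have ht₁' : 0 < 1 - t := sub_pos.2 ht₁
  have hseries : ∑' n : ℤ, (2 : ℝ≥0∞) ^ (-((t / (1 - t) * (γ i - 1)) * Nat.size n.natAbs)) ≠ ∞ := by
    refine ne_top_of_le_ne_top (tsum_cubeMean_rpow_ne_top_of_idIsNuclear (ν := 0)
      (cubeMean_blockWeight_ne_zero hγ 0) (cubeMean_blockWeight_ne_top hγ 0) ht ht₁
      (sub_add_cancel _ _).symm h) ?_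
    refine le_trans (ENNReal.tsum_le_tsum fun n => ?_) (ENNReal.tsum_comp_le_tsum_of_injective
      (Pi.single_injective (M := fun _ => ℤ) i) _)
    calc (2 : ℝ≥0∞) ^ (-((t / (1 - t) * (γ i - 1)) * Nat.size n.natAbs))
        = (2 ^ weightExponent γ 0 (Pi.single i n)) ^ (-(t / (1 - t))) := by
          rw [weightExponent_zero_single, ← ENNReal.rpow_mul]
          ring_nf
      _ ≤ cubeMean (blockWeight γ) 0 (Pi.single i n) ^ (-(t / (1 - t))) := by
          rw [ENNReal.rpow_neg, ENNReal.rpow_neg, ENNReal.inv_le_inv]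
          exact ENNReal.rpow_le_rpow (cubeMean_blockWeight_le hγ 0 _) (div_pos ht ht₁').le
  have hlt := tsum_two_rpow_neg_mul_size_ne_top_iff.1 hseries
  rw [div_mul_eq_mul_div, one_lt_div ht₁'] at hlt
  linarith

end Necessity

section BlockKernel

variable {ι : Type*}

/-- The finite sets `B k` are the blocks of a partition of the index set, `B k` being the block
of `k`. -/
def IsBlockSystem (B : ι → Finset ι) : Prop :=
  ∀ k l, l ∈ B k ↔ B l = B k

/-- A matrix with unimodular entries whose restriction to each block is a complex Hadamard matrix,
that is, has orthogonal columns. -/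
structure IsBlockKernel (B : ι → Finset ι) (U : ι → ι → ℂ) : Prop where
  norm_eq_one : ∀ k l, ‖U k l‖ = 1
  orthogonal : ∀ l, ∀ l' ∈ B l, l ≠ l' → ∑ k ∈ B l, star (U k l) * U k l' = 0

theorem exists_fourier_kernel (S : Finset ι) :
    ∃ u : ι → ι → ℂ, (∀ k l, ‖u k l‖ = 1) ∧
      ∀ l ∈ S, ∀ l' ∈ S, l ≠ l' → ∑ k ∈ S, star (u k l) * u k l' = 0 := by
  classical
  rcases S.eq_empty_or_nonempty with rfl | hS
  · exact ⟨1, by simp⟩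
  have : NeZero S.card := ⟨hS.card_ne_zero⟩
  obtain ⟨e⟩ : Nonempty (S ≃ ZMod S.card) := ⟨Fintype.equivOfCardEq (by simp [ZMod.card])⟩
  let g : ι → ZMod S.card := fun k => if h : k ∈ S then e ⟨k, h⟩ else 0
  have hg (k : S) : g k = e k := by simp [g]
  refine ⟨fun k l => ZMod.stdAddChar (g k * g l), fun k l => AddChar.norm_apply _ _,
    fun l hl l' hl' hll' => ?_⟩
  have hg_sub : g l' - g l ≠ 0 := by
    rw [sub_ne_zero, hg ⟨l', hl'⟩, hg ⟨l, hl⟩, e.injective.ne_iff]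
    exact fun h => hll' (congrArg Subtype.val h).symm
  have hmul (k : ι) : star (ZMod.stdAddChar (g k * g l)) * ZMod.stdAddChar (g k * g l') =
      (ZMod.stdAddChar (g k * (g l' - g l)) : ℂ) := by
    rw [mul_sub, sub_eq_neg_add, AddChar.map_add_eq_mul, AddChar.map_neg_eq_conj, starRingEnd_apply]
  simp only [hmul]
  rw [← Finset.sum_coe_sort S fun k => (ZMod.stdAddChar (g k * (g l' - g l)) : ℂ)]
  simp only [hg]
  rw [e.sum_comp fun x => (ZMod.stdAddChar (x * (g l' - g l)) : ℂ),
    AddChar.sum_mulShift _ (ZMod.isPrimitive_stdAddChar _), if_neg hg_sub, Nat.cast_zero]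

namespace IsBlockSystem

variable {B : ι → Finset ι}

theorem self_mem (hB : IsBlockSystem B) (k : ι) : k ∈ B k := (hB k k).2 rfl

theorem eq_of_mem (hB : IsBlockSystem B) {k l : ι} (h : l ∈ B k) : B l = B k := (hB k l).1 h

theorem mem_comm (hB : IsBlockSystem B) {k l : ι} : l ∈ B k ↔ k ∈ B l := by
  rw [hB, hB, eq_comm]

theorem card_ne_zero (hB : IsBlockSystem B) (k : ι) : (B k).card ≠ 0 :=
  Finset.card_ne_zero_of_mem (hB.self_mem k)

theorem exists_isBlockKernel (hB : IsBlockSystem B) : ∃ U, IsBlockKernel B U := by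
  choose u hu_norm hu_orth using exists_fourier_kernel (ι := ι)
  refine ⟨fun k l => u (B l) k l, fun k l => hu_norm _ k l, fun l l' hl' hll' => ?_⟩
  simp only [hB.eq_of_mem hl']
  exact hu_orth _ l (hB.self_mem l) l' hl' hll'

end IsBlockSystem

/-- The functional `v ↦ (#B)⁻¹ ∑_{l ∈ B} conj (U_{k,l}) v_l`, where `B` is the block of `k`. -/
noncomputable def blockCoeff (B : ι → Finset ι) (U : ι → ι → ℂ) (k : ι) : (ι → ℂ) →ₗ[ℂ] ℂ :=
  ((B k).card : ℂ)⁻¹ • ∑ l ∈ B k, star (U k l) • LinearMap.proj l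

/-- The row `(U_{k,l})_l`, restricted to the block of `k`. -/
noncomputable def blockWave (B : ι → Finset ι) (U : ι → ι → ℂ) (k : ι) : ι → ℂ :=
  (B k : Set ι).indicator (U k)

theorem blockCoeff_apply (B : ι → Finset ι) (U : ι → ι → ℂ) (k : ι) (v : ι → ℂ) :
    blockCoeff B U k v = ((B k).card : ℂ)⁻¹ * ∑ l ∈ B k, star (U k l) * v l := by
  simp only [blockCoeff, LinearMap.smul_apply, LinearMap.sum_apply, LinearMap.proj_apply,
    smul_eq_mul]

namespace IsBlockKernel

variable {B : ι → Finset ι} {U : ι → ι → ℂ}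

theorem enorm_eq_one (hU : IsBlockKernel B U) (k l : ι) : ‖U k l‖ₑ = 1 := by
  rw [← ofReal_norm, hU.norm_eq_one, ENNReal.ofReal_one]

theorem sum_star_mul_self (hU : IsBlockKernel B U) (S : Finset ι) (l : ι) :
    ∑ k ∈ S, star (U k l) * U k l = (S.card : ℂ) := by
  rw [← nsmul_one, ← Finset.sum_const]
  refine Finset.sum_congr rfl fun k _ => ?_
  rw [← starRingEnd_apply, Complex.conj_mul', hU.norm_eq_one, Complex.ofReal_one, one_pow]

theorem sum_blockCoeff_mul (hU : IsBlockKernel B U) (hB : IsBlockSystem B) (v : ι → ℂ) (k : ι) :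
    ∑ k' ∈ B k, blockCoeff B U k' v * U k' k = v k := by
  have hcard : ((B k).card : ℂ) ≠ 0 := Nat.cast_ne_zero.2 (hB.card_ne_zero k)
  calc ∑ k' ∈ B k, blockCoeff B U k' v * U k' k
      = ∑ k' ∈ B k, ∑ l ∈ B k, ((B k).card : ℂ)⁻¹ * (v l * (star (U k' l) * U k' k)) := by
        refine Finset.sum_congr rfl fun k' hk' => ?_
        rw [blockCoeff_apply, hB.eq_of_mem hk', mul_assoc, Finset.sum_mul, Finset.mul_sum]
        exact Finset.sum_congr rfl fun l _ => by ring
    _ = ∑ l ∈ B k, ((B k).card : ℂ)⁻¹ * (v l * ∑ k' ∈ B k, star (U k' l) * U k' k) := by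
        rw [Finset.sum_comm]
        simp only [Finset.mul_sum]
    _ = ((B k).card : ℂ)⁻¹ * (v k * ∑ k' ∈ B k, star (U k' k) * U k' k) := by
        refine Finset.sum_eq_single k (fun l hl hlk => ?_) fun h => absurd (hB.self_mem k) h
        rw [← hB.eq_of_mem hl, hU.orthogonal l k (hB.mem_comm.1 hl) hlk, mul_zero, mul_zero]
    _ = v k := by
        rw [hU.sum_star_mul_self, mul_comm (v k), inv_mul_cancel_left₀ hcard]

theorem hasSum_blockCoeff_mul_blockWave (hU : IsBlockKernel B U) (hB : IsBlockSystem B)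
    (v : ι → ℂ) (k : ι) :
    HasSum (fun k' => blockCoeff B U k' v * blockWave B U k' k) (v k) := by
  have hsupp (k') (hk' : k' ∉ B k) : blockCoeff B U k' v * blockWave B U k' k = 0 := by
    rw [blockWave, Set.indicator_of_notMem (mt hB.mem_comm.1 hk'), mul_zero]
  have hsum : ∑ k' ∈ B k, blockCoeff B U k' v * blockWave B U k' k = v k := by
    rw [← hU.sum_blockCoeff_mul hB v k]
    refine Finset.sum_congr rfl fun k' hk' => ?_
    rw [blockWave, Set.indicator_of_mem (hB.mem_comm.1 hk')]
  exact hsum ▸ hasSum_sum_of_ne_finset_zero hsupp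

theorem hasSum_blockCoeff_mul_single (hU : IsBlockKernel B U) (hB : IsBlockSystem B)
    {N : Type*} [DecidableEq N] (x : N → ι → ℂ) (ν : N) (k : ι) :
    HasSum (fun α : N × ι => blockCoeff B U α.2 (x α.1) *
      (Pi.single α.1 (blockWave B U α.2) : N → ι → ℂ) ν k) (x ν k) := by
  refine ((Prod.mk_right_injective ν).hasSum_iff fun α hα => ?_).1 ?_
  · have hν : ν ≠ α.1 := fun h => hα ⟨α.2, Prod.ext h rfl⟩
    rw [Pi.single_eq_of_ne hν, Pi.zero_apply, mul_zero]
  · simpa only [Function.comp_def, Pi.single_eq_same] using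
      hU.hasSum_blockCoeff_mul_blockWave hB (x ν) k

theorem enorm_blockCoeff_le (hU : IsBlockKernel B U) (hB : IsBlockSystem B) {p : ℝ≥0∞}
    (hp : 1 ≤ p) {W : ι → ℝ≥0∞} {c : ℝ≥0∞} (hc : c ≠ 0) (hc' : c ≠ ∞) {k : ι}
    (hW : ∀ l ∈ B k, c ≤ W l) (v : ι → ℂ) :
    ‖blockCoeff B U k v‖ₑ ≤
      ((B k).card * c) ^ (-(p⁻¹).toReal) * weightedLpNorm p W fun l => ‖v l‖ₑ := by
  have hcard : ((B k).card : ℂ) ≠ 0 := Nat.cast_ne_zero.2 (hB.card_ne_zero k)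
  refine le_trans ?_ (inv_card_mul_sum_le_weightedLpNorm hp _ ⟨k, hB.self_mem k⟩ hc hc' hW)
  rw [blockCoeff_apply, enorm_mul, enorm_inv hcard, ← ofReal_norm (_ : ℂ), Complex.norm_natCast,
    ENNReal.ofReal_natCast]
  gcongr
  refine (enorm_sum_le _ _).trans_eq (Finset.sum_congr rfl fun l _ => ?_)
  rw [enorm_mul, ← ofReal_norm, norm_star, ofReal_norm, hU.enorm_eq_one, one_mul]

theorem weightedLpNorm_blockWave_le (hU : IsBlockKernel B U) {p : ℝ≥0∞} (hp : p ≠ 0)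
    {W : ι → ℝ≥0∞} {C : ℝ≥0∞} {k : ι} (hW : ∀ l ∈ B k, W l ≤ C) :
    weightedLpNorm p W (fun l => ‖blockWave B U k l‖ₑ) ≤ ((B k).card * C) ^ (p⁻¹).toReal := by
  refine weightedLpNorm_le_of_subset hp (B k) (fun l => ?_) (fun l hl => ?_) hW
  · exact (enorm_indicator_le_enorm_self _ _).trans_eq (hU.enorm_eq_one k l)
  · rw [blockWave, Set.indicator_of_notMem (mt Finset.mem_coe.1 hl), enorm_zero]

end IsBlockKernel

end BlockKernel

section NuclearityCriterion

variable {m : ℕ} {w : (Fin m → ℝ) → ℝ} {σ σ₁ σ₂ ε : ℝ} {p p₁ p₂ q q₁ q₂ : ℝ≥0∞}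

theorem weightedLpNorm_two_rpow_ne_top (hq : q ≠ 0) {θ : ℝ} (hθ : θ < 0) :
    weightedLpNorm q (fun _ : ℕ => 1) (fun ν => 2 ^ (ν * θ)) ≠ ∞ := by
  unfold weightedLpNorm
  split_ifs with h
  · refine ne_top_of_le_ne_top ENNReal.one_ne_top (iSup_le fun ν => ?_)
    rw [← ENNReal.rpow_zero (x := 2)]
    exact two_rpow_le_two_rpow (mul_nonpos_of_nonneg_of_nonpos ν.cast_nonneg hθ.le)
  · have ht : 0 < q.toReal := ENNReal.toReal_pos hq h
    refine ENNReal.rpow_ne_top_of_nonneg (by positivity) ?_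
    simp only [mul_one, ← ENNReal.rpow_mul, mul_assoc]
    exact tsum_two_rpow_nat_mul_ne_top_iff.2 (mul_neg_of_neg_of_pos hθ ht)

theorem besovLevelENorm_le_tsum {κ : Type*} (hp : 1 ≤ p) {ν : ℕ} {v : (Fin m → ℤ) → ℂ}
    {y : κ → (Fin m → ℤ) → ℂ} (h : ∀ k, ‖v k‖ₑ ≤ ∑' j, ‖y j k‖ₑ) :
    besovLevelENorm w σ p ν v ≤ ∑' j, besovLevelENorm w σ p ν (y j) := by
  simp only [besovLevelENorm]
  rw [ENNReal.tsum_mul_left]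
  gcongr
  exact (weightedLpNorm_mono p _ h).trans (weightedLpNorm_tsum_le hp _ fun j k => ‖y j k‖ₑ)

-- The factor `2 ^ (ε n_j)` makes the levels summable to the power `q`, so that no triangle
-- inequality for the outer quasi-norm is needed.
theorem besovSeqENorm_le_tsum_mul {κ : Type*} (hp : 1 ≤ p) (hq : q ≠ 0) (ε : ℝ)
    {z : ℕ → (Fin m → ℤ) → ℂ} {n : κ → ℕ} {y : κ → (Fin m → ℤ) → ℂ}
    (h : ∀ ν k, ‖z ν k‖ₑ ≤ ∑' j, ‖(Pi.single (n j) (y j) : ℕ → (Fin m → ℤ) → ℂ) ν k‖ₑ) :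
    besovSeqENorm w σ p q z ≤ (∑' j, 2 ^ (n j * ε) * besovLevelENorm w σ p (n j) (y j)) *
      weightedLpNorm q (fun _ : ℕ => 1) (fun ν => 2 ^ (ν * -ε)) := by
  rw [← weightedLpNorm_const_mul hq, besovSeqENorm_eq]
  refine weightedLpNorm_mono _ _ fun ν => (besovLevelENorm_le_tsum hp (h ν)).trans ?_
  rw [← ENNReal.tsum_mul_right]
  refine ENNReal.tsum_le_tsum fun j => ?_
  by_cases hν : ν = n j
  · rw [hν, Pi.single_eq_same, mul_right_comm, ← two_rpow_add, ← mul_add, add_neg_cancel, mul_zero,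
      ENNReal.rpow_zero, one_mul]
  · rw [Pi.single_eq_of_ne hν, besovLevelENorm_zero (zero_lt_one.trans_le hp).ne']
    exact zero_le

theorem besovSeqENorm_sub_sum_le (hp : 1 ≤ p) (hq : q ≠ 0) (ε : ℝ) {x : ℕ → (Fin m → ℤ) → ℂ}
    {c : ℕ → ℂ} {n : ℕ → ℕ} {y : ℕ → (Fin m → ℤ) → ℂ}
    (hx : ∀ ν k, HasSum (fun j => c j * (Pi.single (n j) (y j) : ℕ → (Fin m → ℤ) → ℂ) ν k) (x ν k))
    (N : ℕ) :
    besovSeqENorm w σ p q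
        (x - ∑ j ∈ Finset.range N, c j • (Pi.single (n j) (y j) : ℕ → (Fin m → ℤ) → ℂ)) ≤
      (∑' j, 2 ^ (n (j + N) * ε) *
        (‖c (j + N)‖ₑ * besovLevelENorm w σ p (n (j + N)) (y (j + N)))) *
      weightedLpNorm q (fun _ : ℕ => 1) (fun ν => 2 ^ (ν * -ε)) := by
  simp only [← besovLevelENorm_const_smul (zero_lt_one.trans_le hp).ne']
  refine besovSeqENorm_le_tsum_mul hp hq ε fun ν k => ?_
  have htail := ((hasSum_nat_add_iff' N).2 (hx ν k)).tsum_eq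
  simp only [Pi.sub_apply, Finset.sum_apply, Pi.single_smul, Pi.smul_apply, smul_eq_mul]
  rw [← htail]
  exact enorm_tsum_le_tsum_enorm

/-- A series `∑_j a_j(x) y_j` for the identity on sequences, in which `y_j` is supported on the
level `n_j`, with bounds for `‖a_j‖ ‖y_j‖` that stay summable after multiplication by
`2 ^ (ε n_j)`. -/
structure IsNuclearSeries (w : (Fin m → ℝ) → ℝ) (σ₁ σ₂ ε : ℝ) (p₁ p₂ q₁ : ℝ≥0∞)
    (a : ℕ → (ℕ → (Fin m → ℤ) → ℂ) →ₗ[ℂ] ℂ) (A : ℕ → ℝ≥0∞) (n : ℕ → ℕ)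
    (y : ℕ → (Fin m → ℤ) → ℂ) : Prop where
  enorm_le : ∀ j x, ‖a j x‖ₑ ≤ A j * besovSeqENorm w σ₁ p₁ q₁ x
  ne_top : ∀ j, A j ≠ ∞
  level_ne_top : ∀ j, besovLevelENorm w σ₂ p₂ (n j) (y j) ≠ ∞
  tsum_ne_top : ∑' j, 2 ^ (n j * ε) * (A j * besovLevelENorm w σ₂ p₂ (n j) (y j)) ≠ ∞
  hasSum : ∀ x ν k,
    HasSum (fun j => a j x * (Pi.single (n j) (y j) : ℕ → (Fin m → ℤ) → ℂ) ν k) (x ν k)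

namespace IsNuclearSeries

variable {a : ℕ → (ℕ → (Fin m → ℤ) → ℂ) →ₗ[ℂ] ℂ} {A : ℕ → ℝ≥0∞} {n : ℕ → ℕ}
  {y : ℕ → (Fin m → ℤ) → ℂ}

theorem besovSeqENorm_sub_sum_le_mul (h : IsNuclearSeries w σ₁ σ₂ ε p₁ p₂ q₁ a A n y)
    (hp₂ : 1 ≤ p₂) (hq₂ : q₂ ≠ 0) (x : ℕ → (Fin m → ℤ) → ℂ) (N : ℕ) :
    besovSeqENorm w σ₂ p₂ q₂
        (x - ∑ j ∈ Finset.range N, a j x • (Pi.single (n j) (y j) : ℕ → (Fin m → ℤ) → ℂ)) ≤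
      (∑' j, 2 ^ (n (j + N) * ε) *
        (A (j + N) * besovLevelENorm w σ₂ p₂ (n (j + N)) (y (j + N)))) *
      (besovSeqENorm w σ₁ p₁ q₁ x *
        weightedLpNorm q₂ (fun _ : ℕ => 1) (fun ν => 2 ^ (ν * -ε))) := by
  refine (besovSeqENorm_sub_sum_le hp₂ hq₂ ε (h.hasSum x) N).trans ?_
  rw [← mul_assoc, ← ENNReal.tsum_mul_right (a := besovSeqENorm w σ₁ p₁ q₁ x)]
  gcongr ?_ * _
  refine ENNReal.tsum_le_tsum fun j => ?_
  rw [mul_assoc, mul_right_comm (A (j + N))]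
  gcongr
  exact h.enorm_le (j + N) x

variable {hp₁ : 0 < p₁} {hp₂ : 0 < p₂} {hq₁ : 0 < q₁} {hq₂ : 0 < q₂}

theorem norm_domRestrict_le (h : IsNuclearSeries w σ₁ σ₂ ε p₁ p₂ q₁ a A n y) (j : ℕ)
    (x : BesovSeq w σ₁ p₁ q₁ hp₁ hq₁) :
    ‖(a j).domRestrict (BesovSeq w σ₁ p₁ q₁ hp₁ hq₁) x‖ ≤ (A j).toReal * ‖x‖ := by
  rw [BesovSeq.norm_def, ← ENNReal.toReal_mul, ← toReal_enorm]
  exact ENNReal.toReal_mono (ENNReal.mul_ne_top (h.ne_top j) x.2.ne) (h.enorm_le j x)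

theorem summable_functionalNorm_mul (h : IsNuclearSeries w σ₁ σ₂ ε p₁ p₂ q₁ a A n y)
    (hε : 0 ≤ ε) :
    Summable fun j => functionalNorm ((a j).domRestrict (BesovSeq w σ₁ p₁ q₁ hp₁ hq₁)) *
      (besovLevelENorm w σ₂ p₂ (n j) (y j)).toReal := by
  refine .of_nonneg_of_le (fun j => mul_nonneg (functionalNorm_nonneg _) ENNReal.toReal_nonneg)
    (fun j => ?_) (ENNReal.summable_toReal h.tsum_ne_top)
  calc functionalNorm ((a j).domRestrict (BesovSeq w σ₁ p₁ q₁ hp₁ hq₁)) *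
        (besovLevelENorm w σ₂ p₂ (n j) (y j)).toReal
      ≤ (A j).toReal * (besovLevelENorm w σ₂ p₂ (n j) (y j)).toReal := by
        gcongr
        exact functionalNorm_le ENNReal.toReal_nonneg (h.norm_domRestrict_le j)
    _ = (A j * besovLevelENorm w σ₂ p₂ (n j) (y j)).toReal := ENNReal.toReal_mul.symm
    _ ≤ _ := by
        refine ENNReal.toReal_mono (ENNReal.ne_top_of_tsum_ne_top h.tsum_ne_top j)
          (le_mul_of_one_le_left' ?_)
        rw [← ENNReal.rpow_zero (x := 2)]
        exact two_rpow_le_two_rpow (by positivity)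

theorem tendsto_besovSeqENorm_sub_sum (h : IsNuclearSeries w σ₁ σ₂ ε p₁ p₂ q₁ a A n y)
    (hp₂ : 1 ≤ p₂) (hq₂ : q₂ ≠ 0) (hε : 0 < ε) {x : ℕ → (Fin m → ℤ) → ℂ}
    (hx : besovSeqENorm w σ₁ p₁ q₁ x ≠ ∞) :
    Tendsto (fun N => besovSeqENorm w σ₂ p₂ q₂
      (x - ∑ j ∈ Finset.range N, a j x • (Pi.single (n j) (y j) : ℕ → (Fin m → ℤ) → ℂ)))
      atTop (𝓝 0) := by
  have htail := ENNReal.Tendsto.mul_const (ENNReal.tendsto_sum_nat_add _ h.tsum_ne_top)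
    (Or.inr (ENNReal.mul_ne_top hx (weightedLpNorm_two_rpow_ne_top hq₂ (neg_neg_of_pos hε))))
  rw [zero_mul] at htail
  exact tendsto_of_tendsto_of_tendsto_of_le_of_le tendsto_const_nhds htail (fun _ => zero_le)
    (h.besovSeqENorm_sub_sum_le_mul hp₂ hq₂ x)

theorem idIsNuclear (h : IsNuclearSeries w σ₁ σ₂ ε p₁ p₂ q₁ a A n y) (hp₂' : 1 ≤ p₂)
    (hε : 0 < ε) :
    IdIsNuclear (BesovSeq w σ₁ p₁ q₁ hp₁ hq₁) (BesovSeq w σ₂ p₂ q₂ hp₂ hq₂) := by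
  set K := weightedLpNorm q₂ (fun _ : ℕ => 1) (fun ν => 2 ^ (ν * -ε))
  set S := ∑' j, 2 ^ (n j * ε) * (A j * besovLevelENorm w σ₂ p₂ (n j) (y j))
  have hK : K ≠ ∞ := weightedLpNorm_two_rpow_ne_top hq₂.ne' (neg_neg_of_pos hε)
  have hS : S ≠ ∞ := h.tsum_ne_top
  have hbound (x : ℕ → (Fin m → ℤ) → ℂ) :
      besovSeqENorm w σ₂ p₂ q₂ x ≤ S * K * besovSeqENorm w σ₁ p₁ q₁ x := by
    simpa only [Finset.range_zero, Finset.sum_empty, sub_zero, add_zero, mul_assoc, mul_comm K]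
      using h.besovSeqENorm_sub_sum_le_mul hp₂' hq₂.ne' x 0
  have hle : BesovSeq w σ₁ p₁ q₁ hp₁ hq₁ ≤ BesovSeq w σ₂ p₂ q₂ hp₂ hq₂ := fun x hx =>
    (hbound x).trans_lt (ENNReal.mul_lt_top (ENNReal.mul_lt_top hS.lt_top hK.lt_top) hx)
  have hy (j : ℕ) : Pi.single (n j) (y j) ∈ BesovSeq w σ₂ p₂ q₂ hp₂ hq₂ :=
    (besovSeqENorm_single hp₂.ne' hq₂.ne' _ _).trans_lt (h.level_ne_top j).lt_top
  refine ⟨hle, ⟨(S * K).toReal, fun x => ?_⟩, fun j => (a j).domRestrict _, fun j => ⟨_, hy j⟩,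
    fun j => ⟨_, h.norm_domRestrict_le j⟩, ?_, fun x => ?_⟩
  · rw [BesovSeq.norm_def, BesovSeq.norm_def, ← ENNReal.toReal_mul]
    exact ENNReal.toReal_mono (ENNReal.mul_ne_top (ENNReal.mul_ne_top hS hK) x.2.ne) (hbound x)
  · simpa only [BesovSeq.norm_def, besovSeqENorm_single hp₂.ne' hq₂.ne'] using
      h.summable_functionalNorm_mul hε.le
  · have hlim := h.tendsto_besovSeqENorm_sub_sum hp₂' hq₂.ne' hε x.2.ne
    refine ((ENNReal.tendsto_toReal ENNReal.zero_ne_top).comp hlim).congr fun N => ?_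
    rw [BesovSeq.norm_def, Function.comp_apply]
    push_cast
    rfl

end IsNuclearSeries

end NuclearityCriterion

section Sufficiency

variable {m : ℕ} {γ : Fin m → ℕ} {ν : ℕ} {σ σ₁ σ₂ : ℝ} {p p₁ p₂ q q₁ q₂ : ℝ≥0∞}
  {hp₁ : 0 < p₁} {hp₂ : 0 < p₂} {hq₁ : 0 < q₁} {hq₂ : 0 < q₂} {U : (Fin m → ℤ) → (Fin m → ℤ) → ℂ}

/-- The multiindices `l` such that `|l_i|` and `|k_i|` have the same binary size for all `i`. -/
noncomputable def indexBlock (k : Fin m → ℤ) : Finset (Fin m → ℤ) :=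
  Fintype.piFinset fun i => sizeBlock (Nat.size (k i).natAbs)

theorem mem_indexBlock {k l : Fin m → ℤ} :
    l ∈ indexBlock k ↔ ∀ i, Nat.size (l i).natAbs = Nat.size (k i).natAbs := by
  simp only [indexBlock, Fintype.mem_piFinset, mem_sizeBlock]

theorem isBlockSystem_indexBlock : IsBlockSystem (indexBlock (m := m)) := fun k l =>
  ⟨fun h => by simp only [indexBlock, mem_indexBlock.1 h],
    fun h => h ▸ mem_indexBlock.2 fun _ => rfl⟩

theorem weightExponent_eq_of_mem_indexBlock {k l : Fin m → ℤ} (h : l ∈ indexBlock k) :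
    weightExponent γ ν l = weightExponent γ ν k := by
  simp only [weightExponent, mem_indexBlock.1 h]

/-- The binary logarithm, up to a bounded error, of `2^{mν}` times the mass of the union of the
cubes `Q_{ν,l}` with `l` in the block of `k`. -/
noncomputable def blockExponent (γ : Fin m → ℕ) (ν : ℕ) (k : Fin m → ℤ) : ℝ :=
  ∑ i, ((γ i : ℝ) * Nat.size (k i).natAbs - ν * ((γ i : ℝ) - 1))

theorem card_indexBlock_mul_two_rpow (γ : Fin m → ℕ) (ν : ℕ) (k : Fin m → ℤ) (c : ℝ) :
    ((indexBlock k).card : ℝ≥0∞) * 2 ^ (weightExponent γ ν k - c) =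
      2 ^ (blockExponent γ ν k - c) := by
  have hcard : ((indexBlock k).card : ℝ≥0∞) = 2 ^ ∑ i, (Nat.size (k i).natAbs : ℝ) := by
    rw [indexBlock, Fintype.card_piFinset]
    simp only [card_sizeBlock]
    rw [Finset.prod_pow_eq_pow_sum, ← Nat.cast_sum, ENNReal.rpow_natCast, Nat.cast_pow,
      Nat.cast_ofNat]
  rw [hcard, ← two_rpow_add, weightExponent, blockExponent, ← add_sub_assoc,
    ← Finset.sum_add_distrib]
  congr 2
  exact Finset.sum_congr rfl fun i _ => by ring

theorem enorm_blockCoeff_indexBlock_le (hγ : ∀ i, 1 ≤ γ i) (hp : 1 ≤ p) (hq : q ≠ 0)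
    (hU : IsBlockKernel indexBlock U) (ν : ℕ) (k : Fin m → ℤ) (x : ℕ → (Fin m → ℤ) → ℂ) :
    ‖blockCoeff indexBlock U k (x ν)‖ₑ ≤
      2 ^ (-(ν * σ) - (blockExponent γ ν k - 2 * ∑ i, (γ i : ℝ)) * (p⁻¹).toReal) *
        besovSeqENorm (blockWeight γ) σ p q x := by
  have hW : ∀ l ∈ indexBlock k,
      2 ^ (weightExponent γ ν k - 2 * ∑ i, (γ i : ℝ)) ≤ cubeMean (blockWeight γ) ν l :=
    fun l hl => weightExponent_eq_of_mem_indexBlock hl ▸ le_cubeMean_blockWeight hγ ν l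
  refine (hU.enorm_blockCoeff_le isBlockSystem_indexBlock hp (two_rpow_ne_zero _)
    (two_rpow_ne_top _) hW (x ν)).trans ?_
  refine le_trans (le_of_eq ?_)
    (mul_le_mul_right (besovLevelENorm_le_besovSeqENorm (σ := σ) hq x ν) _)
  rw [card_indexBlock_mul_two_rpow, ← ENNReal.rpow_mul, besovLevelENorm, ← mul_assoc,
    ← two_rpow_add]
  ring_nf

theorem besovLevelENorm_blockWave_le (hγ : ∀ i, 1 ≤ γ i) (hp : p ≠ 0)
    (hU : IsBlockKernel indexBlock U) (ν : ℕ) (k : Fin m → ℤ) :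
    besovLevelENorm (blockWeight γ) σ p ν (blockWave indexBlock U k) ≤
      2 ^ (ν * σ + blockExponent γ ν k * (p⁻¹).toReal) := by
  have hW : ∀ l ∈ indexBlock k, cubeMean (blockWeight γ) ν l ≤ 2 ^ (weightExponent γ ν k - 0) :=
    fun l hl => by
      rw [sub_zero, ← weightExponent_eq_of_mem_indexBlock hl]
      exact cubeMean_blockWeight_le hγ ν l
  rw [two_rpow_add, ENNReal.rpow_mul 2 (blockExponent γ ν k), ← sub_zero (blockExponent γ ν k),
    ← card_indexBlock_mul_two_rpow, besovLevelENorm]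
  gcongr
  exact hU.weightedLpNorm_blockWave_le hp hW

theorem two_rpow_sum {ι : Type*} (s : Finset ι) (f : ι → ℝ) :
    (2 : ℝ≥0∞) ^ ∑ i ∈ s, f i = ∏ i ∈ s, 2 ^ f i := by
  simp only [← ofReal_two_rpow]
  rw [Real.rpow_sum_of_pos two_pos, ENNReal.ofReal_prod_of_nonneg fun i _ => by positivity]

theorem tsum_two_rpow_sub_sum_size_ne_top (c : ℝ) {θ : ℝ} (hθ : θ < 0) {a : Fin m → ℝ}
    (ha : ∀ i, 1 < a i) :
    ∑' α : ℕ × (Fin m → ℤ), (2 : ℝ≥0∞) ^ (c + α.1 * θ - ∑ i, a i * Nat.size (α.2 i).natAbs) ≠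
      ∞ := by
  have hterm (α : ℕ × (Fin m → ℤ)) :
      (2 : ℝ≥0∞) ^ (c + α.1 * θ - ∑ i, a i * Nat.size (α.2 i).natAbs) =
        2 ^ c * (2 ^ (α.1 * θ) * ∏ i, 2 ^ (-(a i * Nat.size (α.2 i).natAbs))) := by
    rw [sub_eq_add_neg, two_rpow_add, two_rpow_add, mul_assoc, ← Finset.sum_neg_distrib,
      two_rpow_sum]
  simp only [hterm]
  rw [ENNReal.tsum_mul_left, ENNReal.tsum_prod']
  simp only [ENNReal.tsum_mul_left]
  rw [ENNReal.tsum_mul_right,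
    tsum_pi_prod fun i (j : ℤ) => (2 : ℝ≥0∞) ^ (-(a i * Nat.size j.natAbs))]
  exact ENNReal.mul_ne_top (two_rpow_ne_top _)
    (ENNReal.mul_ne_top (tsum_two_rpow_nat_mul_ne_top_iff.2 hθ)
      (ENNReal.prod_ne_top fun i _ => tsum_two_rpow_neg_mul_size_ne_top_iff.2 (ha i)))

theorem two_rpow_mul_blockCoeff_bound_mul_le (hγ : ∀ i, 1 ≤ γ i) (hp₂ : p₂ ≠ 0)
    (hU : IsBlockKernel indexBlock U) {ε r : ℝ}
    (hε : 2 * ε = σ₁ - σ₂ - (∑ i, ((γ i : ℝ) - 1)) * (r - (p₂⁻¹).toReal))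
    (ν : ℕ) (k : Fin m → ℤ) :
    (2 : ℝ≥0∞) ^ (ν * ε) *
        (2 ^ (-(ν * σ₁) - (blockExponent γ ν k - 2 * ∑ i, (γ i : ℝ)) * r) *
          besovLevelENorm (blockWeight γ) σ₂ p₂ ν (blockWave indexBlock U k)) ≤
      2 ^ (2 * (∑ i, (γ i : ℝ)) * r + ν * -ε -
        ∑ i, (r - (p₂⁻¹).toReal) * γ i * Nat.size (k i).natAbs) := by
  refine (mul_le_mul_right
    (mul_le_mul_right (besovLevelENorm_blockWave_le hγ hp₂ hU ν k) _) _).trans_eq ?_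
  have hexp : blockExponent γ ν k =
      ∑ i, (γ i : ℝ) * Nat.size (k i).natAbs - ν * ∑ i, ((γ i : ℝ) - 1) := by
    rw [blockExponent, Finset.sum_sub_distrib, Finset.mul_sum]
  rw [← two_rpow_add, ← two_rpow_add, hexp]
  simp only [mul_assoc, ← Finset.mul_sum]
  congr 1
  linear_combination (ν : ℝ) * hε

theorem idIsNuclear_of_lt (hγ : ∀ i, 1 ≤ γ i) (hp₁' : 1 ≤ p₁) (hp₂' : 1 ≤ p₂)
    (hsize : ∀ i, 1 < ((p₁⁻¹).toReal - (p₂⁻¹).toReal) * γ i)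
    (hlevel : (∑ i, ((γ i : ℝ) - 1)) * ((p₁⁻¹).toReal - (p₂⁻¹).toReal) < σ₁ - σ₂) :
    IdIsNuclear (BesovSeq (blockWeight γ) σ₁ p₁ q₁ hp₁ hq₁)
      (BesovSeq (blockWeight γ) σ₂ p₂ q₂ hp₂ hq₂) := by
  obtain ⟨U, hU⟩ := (isBlockSystem_indexBlock (m := m)).exists_isBlockKernel
  obtain ⟨e⟩ : Nonempty (ℕ ≃ ℕ × (Fin m → ℤ)) := nonempty_equiv_of_countable
  obtain ⟨ε, hε⟩ : ∃ ε, 2 * ε =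
      σ₁ - σ₂ - (∑ i, ((γ i : ℝ) - 1)) * ((p₁⁻¹).toReal - (p₂⁻¹).toReal) :=
    ⟨_, mul_div_cancel₀ _ two_ne_zero⟩
  have hε_pos : 0 < ε := by linarith
  have hseries : IsNuclearSeries (blockWeight γ) σ₁ σ₂ ε p₁ p₂ q₁
      (fun j => blockCoeff indexBlock U (e j).2 ∘ₗ LinearMap.proj (e j).1)
      (fun j => 2 ^ (-((e j).1 * σ₁) -
        (blockExponent γ (e j).1 (e j).2 - 2 * ∑ i, (γ i : ℝ)) * (p₁⁻¹).toReal))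
      (fun j => (e j).1) (fun j => blockWave indexBlock U (e j).2) :=
    { enorm_le := fun j x => enorm_blockCoeff_indexBlock_le hγ hp₁' hq₁.ne' hU _ _ x
      ne_top := fun j => two_rpow_ne_top _
      level_ne_top := fun j => ne_top_of_le_ne_top (two_rpow_ne_top _)
        (besovLevelENorm_blockWave_le hγ hp₂.ne' hU _ _)
      tsum_ne_top := by
        refine ne_top_of_le_ne_top
          (tsum_two_rpow_sub_sum_size_ne_top (2 * (∑ i, (γ i : ℝ)) * (p₁⁻¹).toReal)
            (neg_neg_of_pos hε_pos) hsize) ?_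
        rw [← e.tsum_eq]
        exact ENNReal.tsum_le_tsum fun j =>
          two_rpow_mul_blockCoeff_bound_mul_le hγ hp₂.ne' hU hε _ _
      hasSum := fun x ν k => by
        simpa only [Function.comp_def, LinearMap.comp_apply, LinearMap.proj_apply] using
          e.hasSum_iff.2 (hU.hasSum_blockCoeff_mul_single isBlockSystem_indexBlock x ν k) }
  exact hseries.idIsNuclear hp₂' hε_pos

end Sufficiency

theorem sum_sub_one_mul_lt_iff {m : ℕ} {γ : Fin m → ℕ} {d : ℕ} (hd : d = ∑ i, γ i) (hd_pos : 0 < d)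
    {s₁ s₂ σ₁ σ₂ r₁ r₂ : ℝ} (hσ₁ : σ₁ = s₁ + (m : ℝ) / 2 - (m : ℝ) * r₁)
    (hσ₂ : σ₂ = s₂ + (m : ℝ) / 2 - (m : ℝ) * r₂) :
    (∑ i, ((γ i : ℝ) - 1)) * (r₁ - r₂) < σ₁ - σ₂ ↔ (s₁ - s₂) / (d : ℝ) > r₁ - r₂ := by
  have hsum : ∑ i, ((γ i : ℝ) - 1) = d - m := by
    rw [hd, Finset.sum_sub_distrib, Nat.cast_sum, Finset.sum_const, Finset.card_univ,
      Fintype.card_fin, nsmul_eq_mul, mul_one]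
  rw [gt_iff_lt, lt_div_iff₀ (Nat.cast_pos.2 hd_pos), hsum, hσ₁, hσ₂, ← sub_pos,
    ← sub_pos (a := s₁ - s₂)]
  ring_nf

theorem proposition6_general {m : ℕ} (hm : 0 < m) {γ : Fin m → ℕ} (hγ : ∀ i, 1 ≤ γ i) {d : ℕ}
    (hd : d = ∑ i, γ i) {p₁ p₂ q₁ q₂ : ℝ≥0∞} (hp₁ : 1 ≤ p₁) (hp₂ : 1 ≤ p₂) (hq₁ : 0 < q₁)
    (hq₂ : 0 < q₂) {s₁ s₂ σ₁ σ₂ : ℝ}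
    (hσ₁ : σ₁ = s₁ + (m : ℝ) / 2 - (m : ℝ) * (p₁⁻¹).toReal)
    (hσ₂ : σ₂ = s₂ + (m : ℝ) / 2 - (m : ℝ) * (p₂⁻¹).toReal) :
    IdIsNuclear
        (BesovSeq (blockWeight γ) σ₁ p₁ q₁ (zero_lt_one.trans_le hp₁) hq₁)
        (BesovSeq (blockWeight γ) σ₂ p₂ q₂ (zero_lt_one.trans_le hp₂) hq₂) ↔
      (s₁ - s₂) / (d : ℝ) > (p₁⁻¹).toReal - (p₂⁻¹).toReal ∧
        ∀ i, (p₁⁻¹).toReal - (p₂⁻¹).toReal > 1 / (γ i : ℝ) := by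
  have hd_pos : 0 < d := hd ▸ Finset.sum_pos (fun i _ => hγ i) ⟨⟨0, hm⟩, Finset.mem_univ _⟩
  have hlevel := sum_sub_one_mul_lt_iff hd hd_pos hσ₁ hσ₂
  have hsize (i : Fin m) : 1 < ((p₁⁻¹).toReal - (p₂⁻¹).toReal) * γ i ↔
      (p₁⁻¹).toReal - (p₂⁻¹).toReal > 1 / (γ i : ℝ) :=
    (div_lt_iff₀ (Nat.cast_pos.2 (hγ i))).symm
  refine ⟨fun h => ⟨hlevel.1 (sum_sub_one_mul_lt_of_idIsNuclear hγ h), fun i =>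
    (hsize i).1 (one_lt_mul_of_idIsNuclear hγ h i)⟩, fun ⟨h, h'⟩ => ?_⟩
  exact idIsNuclear_of_lt hγ hp₁ hp₂ (fun i => (hsize i).2 (h' i)) (hlevel.2 h)

theorem forall_one_div_lt_iff {m : ℕ} (hm : 0 < m) {γ : Fin m → ℕ} (hγ_mono : Monotone γ)
    (hγ : 0 < γ ⟨0, hm⟩) {r : ℝ} : (∀ i, r > 1 / (γ i : ℝ)) ↔ r > 1 / (γ ⟨0, hm⟩ : ℝ) :=
  ⟨fun h => h _, fun h i => (one_div_le_one_div_of_le (Nat.cast_pos.2 hγ)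
    (Nat.cast_le.2 (hγ_mono (Nat.zero_le i.val)))).trans_lt h⟩

theorem proposition6 (m : ℕ) (hm : 0 < m) (γ : Fin m → ℕ) (hγ_mono : Monotone γ)
    (hγ : 2 ≤ γ ⟨0, hm⟩) (d : ℕ) (hd : d = ∑ i, γ i)
    (p₁ p₂ q₁ q₂ : ℝ≥0∞) (hp₁ : 1 ≤ p₁) (hp₂ : 1 ≤ p₂) (hq₁ : 0 < q₁) (hq₂ : 0 < q₂)
    (s₁ s₂ σ₁ σ₂ : ℝ)
    (hσ₁ : σ₁ = s₁ + (m : ℝ) / 2 - (m : ℝ) * (p₁⁻¹).toReal)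
    (hσ₂ : σ₂ = s₂ + (m : ℝ) / 2 - (m : ℝ) * (p₂⁻¹).toReal) :
    IdIsNuclear
        (BesovSeq (blockWeight γ) σ₁ p₁ q₁ (zero_lt_one.trans_le hp₁) hq₁)
        (BesovSeq (blockWeight γ) σ₂ p₂ q₂ (zero_lt_one.trans_le hp₂) hq₂) ↔
      (s₁ - s₂) / (d : ℝ) > (p₁⁻¹).toReal - (p₂⁻¹).toReal ∧
        (p₁⁻¹).toReal - (p₂⁻¹).toReal > 1 / (γ ⟨0, hm⟩ : ℝ) := by
  have hγ_pos (i : Fin m) : 1 ≤ γ i := one_le_two.trans (hγ.trans (hγ_mono (Nat.zero_le i.val)))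
  exact (proposition6_general hm hγ_pos hd hp₁ hp₂ hq₁ hq₂ hσ₁ hσ₂).trans
    (and_congr_right' (forall_one_div_lt_iff hm hγ_mono (hγ_pos _)))
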